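/- Let $\mathbb{H}_2$ be the Siegel upper half space of degree $2$, with variable $Z=\begin{pmatrix}\tau&z\\z&\tau'\end{pmatrix}=X+iY$, and let $\Gamma=\mathrm{Sp}_2(\mathbb{Z})$ (integral symplectic $4\times4$ matrices $M=\begin{pmatrix}A&B\\C&D\end{pmatrix}$), $M\circ Z=(AZ+B)(CZ+D)^{-1}$, and $\Gamma_\infty=\{M\in\Gamma : C=0\}$. For $\alpha,\beta\in\mathbb{C}$ with $\alpha-\beta\in\mathbb{Z}$ and $G:\mathbb{H}_2\to\mathbb{C}$ put $$(G|_{(\alpha,\beta)}M)(Z)=\det(CZ+D)^{-\alpha}\,\det(C\overline Z+D)^{-\beta}\,G(M\circ Z),$$ where $w^{-\alpha}\,\overline w^{\,-\beta}:=|w|^{-2\alpha}\,\overline w^{\,\alpha-\beta}$. Let $$\partial_Z=\begin{pmatrix}\partial_\tau&\tfrac12\partial_z\\ \tfrac12\partial_z&\partial_{\tau'}\end{pmatrix},\qquad \partial_{\overline Z}=\begin{pmatrix}\partial_{\overline\tau}&\tfrac12\partial_{\overline z}\\ \tfrac12\partial_{\overline z}&\partial_{\overline{\tau'}}\end{pmatrix},$$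 $K_\alpha=\alpha I_2+(Z-\overline Z)\partial_Z$, $\Lambda_\beta=-\beta I_2+(Z-\overline Z)\partial_{\overline Z}$, and $$\Omega_{\alpha,\beta}=\Lambda_{\beta-\frac32}K_\alpha+\alpha\bigl(\beta-\tfrac32\bigr)I_2 .$$ For an integer $k$, a harmonic Siegel--Maass form of weight $k$ is a real-analytic function $F:\mathbb{H}_2\to\mathbb{C}$ such that 1. $F|_{(\frac12,\,k-\frac12)}M=F$ for all $M\in\Gamma$; 2. $\Omega_{\frac12,\,k-\frac12}(F)=0$; 3. there is $N\in\mathbb{N}$ such that for every $c>0$ there is $C>0$ with $|F(Z)|\le C\,\mathrm{tr}(Y)^N$ for all $Z=X+iY\in\mathbb{H}_2$ with $Y\ge cI_2$ (that is, $Y-cI_2$ positive semidefinite). For an odd integer $k$ and $s\in\mathbb{C}$, the Poincar\'e--Eisenstein series is $$P_{k,s}(Z)=\sum_{M\in\Gamma_\infty\backslash\Gamma}\bigl((\det Y)^s|_{(\frac12,\,k-\frac12)}M\bigr)(Z).$$ **Proposition.** Let $k$ be an odd integer. If $k>3$ and $s=0$, or if $k<0$ and $s=\frac32-k$, then the series $P_{k,s}(Z)$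 converges absolutely for every $Z\in\mathbb{H}_2$, and $P_{k,s}$ is a harmonic Siegel--Maass form of weight $k$. -/

import Mathlib

namespace SiegelMaass

noncomputable section

open Matrix ComplexConjugate

/-- Complex `2 × 2` matrices. -/
abbrev Mat2 := Matrix (Fin 2) (Fin 2) ℂ

/-- The imaginary part `Y` of `Z = X + iY`. -/
def imPart (Z : Mat2) : Matrix (Fin 2) (Fin 2) ℝ := Z.map Complex.im

/-- The Siegel upper half space of degree `2`. Functions on it are represented by functions on
all of `Mat2`, of which only the values on this set are ever used. -/
def siegelHalfSpace : Set Mat2 := {Z | Z.IsSymm ∧ (imPart Z).PosDef}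

/-- The symmetric matrix with coordinates `(τ, z, τ')`. -/
def ofCoords (p : ℂ × ℂ × ℂ) : Mat2 := !![p.1, p.2.1; p.2.1, p.2.2]

/-- Real-analyticity on the Siegel upper half space, in the coordinates `(τ, z, τ')`. -/
def IsRealAnalytic (F : Mat2 → ℂ) : Prop :=
  AnalyticOnNhd ℝ (fun p : ℂ × ℂ × ℂ => F (ofCoords p)) {p | ofCoords p ∈ siegelHalfSpace}

/-! ### The group and its action -/

/-- The full Siegel modular group of degree `2`, consisting of integral `4 × 4` matrices. -/
abbrev Gam := Matrix.symplecticGroup (Fin 2) ℤ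

/-- The block `A` of `M = (A B; C D)`, as a complex matrix; similarly for the others. -/
def blkA (M : Gam) : Mat2 := (M.1.toBlocks₁₁).map (Int.cast : ℤ → ℂ)

def blkB (M : Gam) : Mat2 := (M.1.toBlocks₁₂).map (Int.cast : ℤ → ℂ)

def blkC (M : Gam) : Mat2 := (M.1.toBlocks₂₁).map (Int.cast : ℤ → ℂ)

def blkD (M : Gam) : Mat2 := (M.1.toBlocks₂₂).map (Int.cast : ℤ → ℂ)

/-- `M ∘ Z = (AZ + B)(CZ + D)⁻¹`. -/
def moebius (M : Gam) (Z : Mat2) : Mat2 :=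
  (blkA M * Z + blkB M) * (blkC M * Z + blkD M)⁻¹

/-- `w ^ (-α) * (conj w) ^ (-β)`, where the power of `conj w` is formed with the logarithm
`conj (log w)`. If `α - β` is an integer this does not depend on the choice of the logarithm,
see `autFactor_eq`. -/
def autFactor (α β w : ℂ) : ℂ := w ^ (-α) * conj (w ^ (-conj β))

lemma autFactor_eq (α β w : ℂ) (hw : w ≠ 0) (n : ℤ) (h : α - β = n) :
    autFactor α β w = (‖w‖ : ℂ) ^ (-2 * α) * conj w ^ n := by
  have hn : (‖w‖ : ℂ) ≠ 0 := by simpa using hw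
  have hl : conj (Complex.log w) = 2 * Complex.log (‖w‖ : ℂ) - Complex.log w := by
    rw [← Complex.ofReal_log (norm_nonneg w), ← Complex.log_re]
    have := Complex.add_conj (Complex.log w)
    push_cast at this
    linear_combination this
  have hc : conj w = Complex.exp (2 * Complex.log (‖w‖ : ℂ) - Complex.log w) := by
    rw [← hl, Complex.exp_conj, Complex.exp_log hw]
  rw [autFactor, hc, ← Complex.exp_int_mul, Complex.cpow_def_of_ne_zero hw,
    Complex.cpow_def_of_ne_zero hw, Complex.cpow_def_of_ne_zero hn, ← Complex.exp_conj,
    ← Complex.exp_add, ← Complex.exp_add, map_mul, hl, ← h]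
  congr 1
  simp
  ring

/-- The slash operator `G |_(α,β) M`. -/
def slash (α β : ℂ) (G : Mat2 → ℂ) (M : Gam) (Z : Mat2) : ℂ :=
  autFactor α β (blkC M * Z + blkD M).det * G (moebius M Z)

/-! ### Differential operators -/

/-- The coordinate direction belonging to the `(i, j)` entry of a symmetric matrix. -/
def symDir (i j : Fin 2) : Mat2 :=
  if i = j then Matrix.single i i 1 else Matrix.single i j 1 + Matrix.single j i 1

/-- The Wirtinger derivative `∂/∂Z_ij = (∂/∂X_ij - i ∂/∂Y_ij) / 2`. -/
def wirt (i j : Fin 2) (F : Mat2 → ℂ) (Z : Mat2) : ℂ :=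
  (1 / 2) * (lineDeriv ℝ F Z (symDir i j)
    - Complex.I * lineDeriv ℝ F Z (Complex.I • symDir i j))

/-- The conjugate Wirtinger derivative `(∂/∂X_ij + i ∂/∂Y_ij) / 2`. -/
def wirtBar (i j : Fin 2) (F : Mat2 → ℂ) (Z : Mat2) : ℂ :=
  (1 / 2) * (lineDeriv ℝ F Z (symDir i j)
    + Complex.I * lineDeriv ℝ F Z (Complex.I • symDir i j))

/-- The weight `1` on the diagonal and `1/2` off the diagonal in the matrices `∂_Z`, `∂_Zbar`. -/
def entryWeight (i j : Fin 2) : ℂ := if i = j then 1 else 1 / 2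

/-- The matrix `∂_Z F`. -/
def dZ (F : Mat2 → ℂ) (Z : Mat2) : Mat2 :=
  Matrix.of fun i j => entryWeight i j * wirt i j F Z

/-- The matrix product `∂_Zbar G` of the matrix of operators `∂_Zbar` with a matrix-valued
function `G`. -/
def dZbar (G : Mat2 → Mat2) (Z : Mat2) : Mat2 :=
  Matrix.of fun i j => ∑ l, entryWeight i l * wirtBar i l (fun W => G W l j) Z

/-- `Z - conj Z`. -/
def subConj (Z : Mat2) : Mat2 := Z - Z.map conj

/-- `K_α = α I₂ + (Z - conj Z) ∂_Z`, applied to a scalar function. -/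
def opK (α : ℂ) (F : Mat2 → ℂ) (Z : Mat2) : Mat2 :=
  (α * F Z) • (1 : Mat2) + subConj Z * dZ F Z

/-- `Λ_β = -β I₂ + (Z - conj Z) ∂_Zbar`, applied to a matrix-valued function. -/
def opLambda (β : ℂ) (G : Mat2 → Mat2) (Z : Mat2) : Mat2 :=
  (-β) • G Z + subConj Z * dZbar G Z

/-- The matrix-valued Laplace operator
`Ω_{α,β} = Λ_{β - 3/2} K_α + α (β - 3/2) I₂`. -/
def opOmega (α β : ℂ) (F : Mat2 → ℂ) (Z : Mat2) : Mat2 :=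
  opLambda (β - 3 / 2) (opK α F) Z + (α * (β - 3 / 2) * F Z) • (1 : Mat2)

/-! ### Harmonic Siegel–Maass forms -/

/-- Harmonic Siegel–Maass forms of weight `k` on the full Siegel modular group of degree `2`.
The growth condition is imposed on the domains `Y ≥ c I₂`, `c > 0`. -/
structure IsHarmonicSiegelMaassForm (k : ℤ) (F : Mat2 → ℂ) : Prop where
  analytic : IsRealAnalytic F
  slash_eq : ∀ M : Gam, ∀ Z ∈ siegelHalfSpace,
    slash (1 / 2) ((k : ℂ) - 1 / 2) F M Z = F Z
  harmonic : ∀ Z ∈ siegelHalfSpace, opOmega (1 / 2) ((k : ℂ) - 1 / 2) F Z = 0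
  growth : ∃ N : ℕ, ∀ c : ℝ, 0 < c → ∃ C : ℝ, 0 < C ∧ ∀ Z ∈ siegelHalfSpace,
    (imPart Z - c • (1 : Matrix (Fin 2) (Fin 2) ℝ)).PosSemidef →
      ‖F Z‖ ≤ C * (imPart Z).trace ^ N

/-! ### The Poincaré–Eisenstein series -/

lemma toBlocks₂₁_mul (M N : Matrix (Fin 2 ⊕ Fin 2) (Fin 2 ⊕ Fin 2) ℤ) :
    (M * N).toBlocks₂₁ = M.toBlocks₂₁ * N.toBlocks₁₁ + M.toBlocks₂₂ * N.toBlocks₂₁ := by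
  conv_lhs => rw [← fromBlocks_toBlocks M, ← fromBlocks_toBlocks N, fromBlocks_multiply]
  simp

lemma toBlocks₂₁_inv (M : Gam) : (M⁻¹ : Gam).1.toBlocks₂₁ = -(M.1.toBlocks₂₁)ᵀ := by
  rw [SymplecticGroup.coe_inv]
  conv_lhs => rw [← fromBlocks_toBlocks M.1]
  simp [Matrix.J, fromBlocks_transpose, fromBlocks_multiply, Matrix.fromBlocks_neg]

/-- The subgroup of all `(A B; C D)` with `C = 0`. -/
def gamInfty : Subgroup Gam where
  carrier := {M | M.1.toBlocks₂₁ = 0}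
  mul_mem' := by
    intro M N hM hN
    simp only [Set.mem_ofPred_eq] at hM hN ⊢
    rw [Submonoid.coe_mul, toBlocks₂₁_mul, hM, hN]
    simp
  one_mem' := by
    simp only [Set.mem_ofPred_eq, OneMemClass.coe_one]
    rw [← fromBlocks_one, toBlocks_fromBlocks₂₁]
  inv_mem' := by
    intro M hM
    simp only [Set.mem_ofPred_eq] at hM ⊢
    rw [toBlocks₂₁_inv, hM]
    simp

/-- The set of cosets `Γ_∞ M`. -/
abbrev Cosets := Quotient (QuotientGroup.rightRel gamInfty)

/-- `(det Y) ^ s |_(1/2, k - 1/2) M`. -/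
def poincareTerm (k : ℤ) (s : ℂ) (M : Gam) (Z : Mat2) : ℂ :=
  slash (1 / 2) ((k : ℂ) - 1 / 2) (fun W => (((imPart W).det : ℝ) : ℂ) ^ s) M Z

lemma poincareTerm_rightRel (k : ℤ) (hk : Odd k) (s : ℂ) (M N : Gam)
    (h : QuotientGroup.rightRel gamInfty M N) (Z : Mat2) :
    poincareTerm k s M Z = poincareTerm k s N Z := by
  rw [QuotientGroup.rightRel_apply] at h
  obtain ⟨P, hP, rfl⟩ : ∃ P : Gam, P ∈ gamInfty ∧ N = P * M := ⟨N * M⁻¹, h, by group⟩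
  have hC : P.1.toBlocks₂₁ = 0 := hP
  obtain ⟨m, hm⟩ := hk
  have hsym := SymplecticGroup.mem_iff.1 P.2
  rw [← fromBlocks_toBlocks P.1, hC] at hsym
  simp only [Matrix.J, fromBlocks_multiply, fromBlocks_transpose] at hsym
  have hAD : P.1.toBlocks₁₁ * (P.1.toBlocks₂₂)ᵀ = 1 := by
    have := congrArg toBlocks₁₂ hsym
    simpa using this
  set A := P.1.toBlocks₁₁ with hA
  set B := P.1.toBlocks₁₂ with hB
  set D := P.1.toBlocks₂₂ with hD
  have hmul : (P * M : Gam).1 = fromBlocks A B 0 D * M.1 := by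
    rw [Submonoid.coe_mul, ← hC, hA, hB, hD, fromBlocks_toBlocks]
  rw [← fromBlocks_toBlocks M.1, fromBlocks_multiply] at hmul
  let c : Matrix (Fin 2) (Fin 2) ℤ → Mat2 := fun X => X.map (Int.cast : ℤ → ℂ)
  have cmul : ∀ X Y, c (X * Y) = c X * c Y := fun X Y =>
    Matrix.map_mul (f := Int.castRingHom ℂ)
  have cadd : ∀ X Y, c (X + Y) = c X + c Y := fun X Y =>
    Matrix.map_add _ (fun _ _ => Int.cast_add _ _) _ _
  have e1 : blkA (P * M) = c A * blkA M + c B * blkC M := by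
    simp only [blkA, hmul, toBlocks_fromBlocks₁₁]; exact (cadd _ _).trans (by rw [cmul, cmul]; rfl)
  have e2 : blkB (P * M) = c A * blkB M + c B * blkD M := by
    simp only [blkB, hmul, toBlocks_fromBlocks₁₂]; exact (cadd _ _).trans (by rw [cmul, cmul]; rfl)
  have e3 : blkC (P * M) = c D * blkC M := by
    simp only [blkC, hmul, toBlocks_fromBlocks₂₁, Matrix.zero_mul, zero_add]; exact cmul _ _
  have e4 : blkD (P * M) = c D * blkD M := by
    simp only [blkD, hmul, toBlocks_fromBlocks₂₂, Matrix.zero_mul, zero_add]; exact cmul _ _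
  have hADc : c A * (c D)ᵀ = 1 := by
    have : c D = (c Dᵀ)ᵀ := by ext; rfl
    rw [this, transpose_transpose, ← cmul, hAD]
    simp [c]
  have hDA : c D * (c A)ᵀ = 1 := by
    have := congrArg transpose hADc
    simpa using this
  have hinv : (c D)⁻¹ = (c A)ᵀ := Matrix.inv_eq_right_inv hDA
  have hdet : D.det = 1 ∨ D.det = -1 := by
    have := congrArg det hAD
    rw [det_mul, det_transpose, det_one] at this
    exact Int.isUnit_iff.1 (IsUnit.of_mul_eq_one _ ((mul_comm _ _).trans this))
  have hdetc : (c D).det = 1 ∨ (c D).det = -1 := by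
    have : (c D).det = (D.det : ℂ) := ((Int.castRingHom ℂ).map_det D).symm
    rw [this]
    rcases hdet with h | h <;> simp [h]
  set Q := blkC M * Z + blkD M with hQ
  have hQ' : blkC (P * M) * Z + blkD (P * M) = c D * Q := by
    rw [e3, e4, hQ, Matrix.mul_add, Matrix.mul_assoc]
  unfold poincareTerm slash
  rw [hQ', ← hQ, det_mul]
  by_cases h0 : Q.det = 0
  · simp [h0, autFactor]
  have hne : (c D).det * Q.det ≠ 0 := by
    refine mul_ne_zero ?_ h0
    rcases hdetc with h | h <;> simp [h]
  have hab : (1 / 2 : ℂ) - ((k : ℂ) - 1 / 2) = ((2 * -m : ℤ) : ℂ) := by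
    rw [hm]; push_cast; ring
  have hfac : autFactor (1 / 2) ((k : ℂ) - 1 / 2) ((c D).det * Q.det) =
      autFactor (1 / 2) ((k : ℂ) - 1 / 2) Q.det := by
    rw [autFactor_eq _ _ _ hne _ hab, autFactor_eq _ _ _ h0 _ hab]
    rcases hdetc with h | h
    · simp [h]
    · rw [h, neg_one_mul, norm_neg, map_neg, Even.neg_zpow (even_two_mul _)]
  rw [hfac]
  have hW : moebius (P * M) Z = c A * moebius M Z * (c A)ᵀ + c B * (c A)ᵀ := by
    have hu : IsUnit Q.det := isUnit_iff_ne_zero.2 h0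
    unfold moebius
    rw [hQ', ← hQ, Matrix.mul_inv_rev, hinv, e1, e2]
    have : (c A * blkA M + c B * blkC M) * Z + (c A * blkB M + c B * blkD M) =
        c A * (blkA M * Z + blkB M) + c B * Q := by
      rw [hQ]; noncomm_ring
    rw [this, Matrix.add_mul, ← Matrix.mul_assoc, ← Matrix.mul_assoc,
      Matrix.mul_assoc (c B) Q, Matrix.mul_assoc (c B), Matrix.mul_assoc Q,
      ← Matrix.mul_assoc Q, Matrix.mul_nonsing_inv _ hu]
    simp [Matrix.mul_assoc]
  have him : imPart (moebius (P * M) Z) =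
      A.map (Int.cast : ℤ → ℝ) * imPart (moebius M Z) * (A.map (Int.cast : ℤ → ℝ))ᵀ := by
    rw [hW]
    ext i j
    simp [imPart, c, Matrix.mul_apply, Fin.sum_univ_two]
  have hA2 : (A.map (Int.cast : ℤ → ℝ)).det * (A.map (Int.cast : ℤ → ℝ)).det = 1 := by
    have e : (A.map (Int.cast : ℤ → ℝ)).det = (A.det : ℝ) := ((Int.castRingHom ℝ).map_det A).symm
    have := congrArg det hAD
    rw [det_mul, det_transpose, det_one] at this
    rw [e]
    rcases Int.isUnit_iff.1 (IsUnit.of_mul_eq_one _ this) with h | h <;> simp [h]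
  have hdY : (imPart (moebius (P * M) Z)).det = (imPart (moebius M Z)).det := by
    rw [him, det_mul, det_mul, det_transpose]
    linear_combination (imPart (moebius M Z)).det * hA2
  simp only [hdY]

/-- The Poincaré–Eisenstein series `P_{k,s}`: the sum of `(det Y) ^ s |_(1/2, k - 1/2) M` over
a set of representatives `M` of the cosets. For odd `k` the summand depends only on the coset,
see `poincareTerm_rightRel`. -/
def poincareSeries (k : ℤ) (s : ℂ) (Z : Mat2) : ℂ :=
  ∑' q : Cosets, poincareTerm k s q.out Z

end

end SiegelMaass

namespace SiegelMaass

noncomputable section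

open Matrix ComplexConjugate

/-! ### Counting isotropic vectors -/

open scoped ENNReal

/-! By expansion, det(CZ + D) is w_v(Z) = a det Z + r τ + p τ' + 2 q z + d, where the integral
vector v collects the 2 × 2 minors of (C D). The rows of (C D) span a Lagrangian plane, so v is
nonzero and lies on the quadric a d = p r - q², and v determines the coset Γ_∞ M
(`rightRel_of_minors_eq`). Since det Im(M ∘ Z) = det Y / |w_v|², the series runs over distinct
isotropic vectors with terms (det Y)^s |w_v|^(-1-2s) conj(w_v)^(1-k), of absolute value (det Y)^s
|w_v|^(-(k+2s)).

Convergence rests on two estimates. The height of v is O(|w_v(Z)|), uniformly for bounded X and Y ≥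
c (`exists_height_le`), and height^(-4) is summable over isotropic vectors by a divisor bound
(`summable_height_rpow`). In both cases k + 2s ≥ 4: it equals k or 3 - k. Uniformity together with
periodicity in X gives the growth condition with N = 2s.

Each term is annihilated by Ω because s (3/2 - k - s) = 0 (`opOmegaE_localTerm`). With U = Z - conj
Z and V = w⁻¹ ∂_Z w, the input is conj(V) (1 - U V) = V, which encodes the isotropy of v.

No termwise differentiation is estimated. Near a point x₀ the series is L ∘ Ψ, where Ψ is a
real-analytic map into the Banach algebra of bounded families and L is a continuous linear
functional with summable coefficients. Analyticity is then immediate, and Ω passes through L and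
through evaluation at each index (`analyticAt_tsum_and_opOmegaE_tsum`).

Invariance is a permutation of the cosets by right multiplication. Oddness of k makes the exponent 1
- k even, so the choice of representatives does not matter. -/

lemma add_one_pow_three_le (e : ℕ) : (e + 1) ^ 3 ≤ 8 * 2 ^ e := by
  rcases lt_or_ge e 5 with h | h
  · interval_cases e <;> norm_num
  · induction e, h using Nat.le_induction with
    | base => norm_num
    | succ n hn ih =>
      rw [pow_succ 2]
      nlinarith [mul_le_mul hn hn (by norm_num) (by omega), Nat.zero_le (n ^ 3)]

lemma add_one_le_two_pow (e : ℕ) : e + 1 ≤ 2 ^ e := Nat.lt_two_pow_self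

/-- A divisor bound: the number of divisors of `n` is `O(n ^ (1 / 3))`. -/
lemma card_divisors_pow_three_le {n : ℕ} (hn : n ≠ 0) : n.divisors.card ^ 3 ≤ 8 ^ 8 * n := by
  -- For p ≥ 8 one has (e + 1)³ ≤ 8^e ≤ p^e with no loss; a smaller prime costs a factor 8, and
  -- there are fewer than eight of these.
  have h1 : ∀ p ∈ n.primeFactors, (n.factorization p + 1) ^ 3 ≤
      (if p < 8 then 8 else 1) * p ^ n.factorization p := by
    intro p hp
    have hp2 := (Nat.prime_of_mem_primeFactors hp).two_le
    split_ifs with h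
    · exact (add_one_pow_three_le _).trans (Nat.mul_le_mul_left _ (Nat.pow_le_pow_left hp2 _))
    · rw [one_mul]
      calc (n.factorization p + 1) ^ 3 ≤ (2 ^ n.factorization p) ^ 3 :=
            Nat.pow_le_pow_left (add_one_le_two_pow _) _
        _ = 8 ^ n.factorization p := by rw [← pow_mul, mul_comm, pow_mul]; norm_num
        _ ≤ _ := Nat.pow_le_pow_left (by omega) _
  have h2 : ∏ p ∈ n.primeFactors, (if p < 8 then 8 else 1) ≤ 8 ^ 8 := by
    rw [← Finset.prod_filter, Finset.prod_const]
    refine Nat.pow_le_pow_right (by norm_num) ?_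
    calc _ ≤ (Finset.range 8).card := Finset.card_le_card (fun p hp => by
          simpa using (Finset.mem_filter.1 hp).2)
      _ = 8 := by simp
  rw [Nat.card_divisors hn, ← Finset.prod_pow]
  calc _ ≤ ∏ p ∈ n.primeFactors, (if p < 8 then 8 else 1) * p ^ n.factorization p :=
        Finset.prod_le_prod' h1
    _ = (∏ p ∈ n.primeFactors, (if p < 8 then 8 else 1)) *
        ∏ p ∈ n.primeFactors, p ^ n.factorization p := Finset.prod_mul_distrib
    _ ≤ _ := by
        refine Nat.mul_le_mul h2 (le_of_eq ?_)
        exact Nat.prod_factorization_pow_eq_self hn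

/-- Every nonzero integer `n` is a product of two integers in `O(n ^ (1 / 3))` ways. -/
lemma card_divisorsAntidiag_le (n : ℤ) :
    (n.divisorsAntidiag.card : ℝ) ≤ 2 * 8 ^ 8 * |(n : ℝ)| ^ (1 / 3 : ℝ) := by
  rcases eq_or_ne n 0 with rfl | hn
  · simp
  have hcard : n.divisorsAntidiag.card ≤ 2 * n.natAbs.divisors.card := by
    -- A factorization of n is recovered from the absolute value and the sign of its first factor.
    have hsub : n.divisorsAntidiag ⊆
        (n.natAbs.divisors ×ˢ ({1, -1} : Finset ℤ)).image
          (fun x => ((x.1 : ℤ) * x.2, n / ((x.1 : ℤ) * x.2))) := by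
      rintro ⟨x, y⟩ h
      rw [Int.mem_divisorsAntidiag] at h
      obtain ⟨h, -⟩ := h
      simp only at h
      have hx : x ≠ 0 := by rintro rfl; simp at h; exact hn h.symm
      refine Finset.mem_image.2 ⟨(x.natAbs, x.sign), ?_, ?_⟩
      · rw [Finset.mem_product, Nat.mem_divisors]
        refine ⟨⟨?_, by simpa using hn⟩, ?_⟩
        · exact Int.natAbs_dvd_natAbs.2 ⟨y, h.symm⟩
        · rcases lt_trichotomy x 0 with h | h | h
          · simp [Int.sign_eq_neg_one_of_neg h]
          · exact absurd h hx
          · simp [Int.sign_eq_one_of_pos h]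
      · have : (x.natAbs : ℤ) * x.sign = x := by rw [mul_comm]; exact Int.sign_mul_natAbs x
        simp only [this]
        rw [← h, Int.mul_ediv_cancel_left _ hx]
    calc _ ≤ _ := Finset.card_le_card hsub
      _ ≤ _ := Finset.card_image_le
      _ = _ := by rw [Finset.card_product]; simp [mul_comm]
  have h3 := card_divisors_pow_three_le (n := n.natAbs) (by simpa using hn)
  have h3' : (n.natAbs.divisors.card : ℝ) ^ 3 ≤ 8 ^ 8 * |(n : ℝ)| := by
    have : ((n.natAbs : ℕ) : ℝ) = |(n : ℝ)| := by rw [Nat.cast_natAbs]; push_cast; rfl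
    rw [← this]; exact_mod_cast h3
  have h4 : (n.natAbs.divisors.card : ℝ) ≤ 8 ^ 8 * |(n : ℝ)| ^ (1 / 3 : ℝ) := by
    refine le_of_pow_le_pow_left₀ three_ne_zero (by positivity) (h3'.trans ?_)
    rw [mul_pow, ← Real.rpow_natCast (|(n : ℝ)| ^ (1 / 3 : ℝ)), ← Real.rpow_mul (abs_nonneg _)]
    norm_num
    gcongr
    norm_num
  calc (n.divisorsAntidiag.card : ℝ) ≤ 2 * n.natAbs.divisors.card := by exact_mod_cast hcard
    _ ≤ _ := by rw [mul_assoc]; gcongr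

/-- The weight `(1 + |x|) ^ (-e)`. -/
def wgt (e : ℝ) (x : ℤ) : ℝ≥0∞ := ENNReal.ofReal ((1 + |(x : ℝ)|) ^ (-e))

lemma le_wgt {e t : ℝ} (he : 0 ≤ e) {x : ℤ} (hx : 1 + |(x : ℝ)| ≤ t) :
    ENNReal.ofReal (t ^ (-e)) ≤ wgt e x :=
  ENNReal.ofReal_le_ofReal (Real.rpow_le_rpow_of_nonpos (by positivity) hx (by linarith))

lemma tsum_wgt_ne_top {e : ℝ} (he : 1 < e) : ∑' x : ℤ, wgt e x ≠ ⊤ := by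
  have : Summable fun x : ℤ => (1 + |(x : ℝ)|) ^ (-e) := by
    have h1 := (Real.summable_abs_int_rpow he)
    have h2 : Summable fun x : ℤ => (if x = 0 then (1 : ℝ) else 0) :=
      summable_of_ne_finset_zero (s := {0}) (by intro b hb; simpa using hb)
    refine Summable.of_nonneg_of_le (fun x => by positivity) (fun x => ?_) (h1.add h2)
    rcases eq_or_ne x 0 with rfl | hx
    · simp
      positivity
    · have : 0 < |(x : ℝ)| := by simpa using hx
      simp only [hx, if_false, add_zero]
      exact Real.rpow_le_rpow_of_nonpos this (by linarith) (by linarith)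
  exact this.tsum_ofReal_ne_top

/-- A weight on the factorizations `n = x * y` which is summable uniformly in `n`. -/
def factorWgt (n : ℤ) (z : ℤ × ℤ) : ℝ≥0∞ :=
  if z.1 * z.2 = n then
    if n = 0 then wgt (10 / 9) z.1 * wgt (10 / 9) z.2 else wgt (1 / 3) z.1 * wgt (1 / 3) z.2
  else 0

/-- For n ≠ 0 each factorization has weight at most |n|^(-1/3), which balances the divisor bound.
For n = 0 there are infinitely many factorizations, and the exponent 10/9 > 1 makes the sum
converge. -/
lemma exists_tsum_factorWgt_le : ∃ C : ℝ≥0∞, C ≠ ⊤ ∧ ∀ n, ∑' z, factorWgt n z ≤ C := by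
  set H := ∑' x : ℤ, wgt (10 / 9) x with hH
  have hHt : H ≠ ⊤ := tsum_wgt_ne_top (by norm_num)
  refine ⟨H * H + ENNReal.ofReal (2 * 8 ^ 8),
    ENNReal.add_ne_top.2 ⟨ENNReal.mul_ne_top hHt hHt, ENNReal.ofReal_ne_top⟩, fun n => ?_⟩
  rcases eq_or_ne n 0 with rfl | hn
  · refine le_add_right ?_
    calc ∑' z, factorWgt 0 z ≤ ∑' z : ℤ × ℤ, wgt (10 / 9) z.1 * wgt (10 / 9) z.2 := by
          refine ENNReal.tsum_le_tsum fun z => ?_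
          rw [factorWgt, if_pos (rfl : (0 : ℤ) = 0)]
          split_ifs <;> simp
      _ = H * H := by
          rw [ENNReal.tsum_prod']
          simp_rw [ENNReal.tsum_mul_left, ENNReal.tsum_mul_right]
          rfl
  · refine le_add_left ?_
    have hsupp : ∀ z ∉ n.divisorsAntidiag, factorWgt n z = 0 := by
      intro z hz
      rw [Int.mem_divisorsAntidiag] at hz
      rw [factorWgt, if_neg (fun h => hz ⟨h, hn⟩)]
    rw [tsum_eq_sum hsupp]
    have hpos : 0 < |(n : ℝ)| := by simpa using hn
    have hle : ∀ z ∈ n.divisorsAntidiag,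
        factorWgt n z ≤ ENNReal.ofReal (|(n : ℝ)| ^ (-(1 / 3) : ℝ)) := by
      rintro ⟨x, y⟩ hz
      rw [Int.mem_divisorsAntidiag] at hz
      obtain ⟨hz, -⟩ := hz
      simp only at hz
      simp only [factorWgt, hz, hn, if_true, if_false, wgt]
      rw [← ENNReal.ofReal_mul (by positivity), ← Real.mul_rpow (by positivity) (by positivity)]
      refine ENNReal.ofReal_le_ofReal (Real.rpow_le_rpow_of_nonpos hpos ?_ (by norm_num))
      rw [← hz, Int.cast_mul, abs_mul]
      gcongr <;> simp
    refine (Finset.sum_le_card_nsmul _ _ _ hle).trans ?_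
    rw [nsmul_eq_mul, ← ENNReal.ofReal_natCast, ← ENNReal.ofReal_mul (by positivity)]
    refine ENNReal.ofReal_le_ofReal ?_
    calc _ ≤ 2 * 8 ^ 8 * |(n : ℝ)| ^ (1 / 3 : ℝ) * |(n : ℝ)| ^ (-(1 / 3) : ℝ) := by
          gcongr; exact card_divisorsAntidiag_le n
      _ = _ := by rw [mul_assoc, ← Real.rpow_add hpos]; norm_num

/-- The coordinates `((p, q, r), (a, d))` of an integral vector. -/
abbrev Vec5 := (ℤ × ℤ × ℤ) × (ℤ × ℤ)

/-- Isotropy of a vector: `a * d = p * r - q ^ 2`. -/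
def IsIsotropic (v : Vec5) : Prop := v.2.1 * v.2.2 = v.1.1 * v.1.2.2 - v.1.2.1 ^ 2

/-- The height of an integral vector. -/
def height (v : Vec5) : ℝ :=
  1 + |(v.1.1 : ℝ)| + |(v.1.2.1 : ℝ)| + |(v.1.2.2 : ℝ)| + |(v.2.1 : ℝ)| + |(v.2.2 : ℝ)|

lemma one_le_height (v : Vec5) : 1 ≤ height v := by
  have := abs_nonneg (v.1.1 : ℝ); have := abs_nonneg (v.1.2.1 : ℝ)
  have := abs_nonneg (v.1.2.2 : ℝ); have := abs_nonneg (v.2.1 : ℝ)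
  have := abs_nonneg (v.2.2 : ℝ)
  unfold height
  linarith

lemma ofReal_rpow_add {t a b : ℝ} (ht : 0 < t) :
    ENNReal.ofReal (t ^ (-(a + b))) = ENNReal.ofReal (t ^ (-a)) * ENNReal.ofReal (t ^ (-b)) := by
  rw [← ENNReal.ofReal_mul (by positivity), ← Real.rpow_add ht]
  congr 2; ring

/-- The number of isotropic integral vectors of height at most `T` is so small that
`height ^ (-4)` is summable over them. -/
theorem summable_height_rpow :
    Summable fun v : {v : Vec5 // IsIsotropic v} => height v.1 ^ (-4 : ℝ) := by
  obtain ⟨C, hC, hCn⟩ := exists_tsum_factorWgt_le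
  set H := ∑' x : ℤ, wgt (10 / 9) x with hH
  have hHt : H ≠ ⊤ := tsum_wgt_ne_top (by norm_num)
  -- A summable majorant for the triples (p, q, r): the first summand serves the case p r ≠ q², the
  -- second the degenerate cone p r = q², where p and r are counted as a factorization of q².
  let X : ℤ × ℤ × ℤ → ℝ≥0∞ := fun u =>
    wgt (10 / 9) u.1 * (wgt (10 / 9) u.2.1 * wgt (10 / 9) u.2.2) +
      wgt (10 / 9) u.2.1 * factorWgt (u.2.1 ^ 2) (u.1, u.2.2)
  have hX : ∑' u, X u ≤ H * (H * H) + H * C := by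
    rw [ENNReal.tsum_add]
    refine add_le_add ?_ ?_
    · rw [ENNReal.tsum_prod']
      simp_rw [ENNReal.tsum_prod', ENNReal.tsum_mul_left, ENNReal.tsum_mul_right]
      rfl
    · calc ∑' u : ℤ × ℤ × ℤ, wgt (10 / 9) u.2.1 * factorWgt (u.2.1 ^ 2) (u.1, u.2.2)
          = ∑' q : ℤ, wgt (10 / 9) q * ∑' z : ℤ × ℤ, factorWgt (q ^ 2) z := by
            simp_rw [ENNReal.tsum_prod', ← ENNReal.tsum_mul_left]
            rw [ENNReal.tsum_comm]
        _ ≤ ∑' q : ℤ, wgt (10 / 9) q * C :=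
            ENNReal.tsum_le_tsum fun q => mul_le_mul_right (hCn _) _
        _ = H * C := ENNReal.tsum_mul_right
  let Y : Vec5 → ℝ≥0∞ := fun v => X v.1 * factorWgt (v.1.1 * v.1.2.2 - v.1.2.1 ^ 2) v.2
  have hY : ∑' v, Y v ≠ ⊤ := by
    have : ∑' v, Y v ≤ (H * (H * H) + H * C) * C := by
      rw [ENNReal.tsum_prod']
      simp only [Y, ENNReal.tsum_mul_left]
      calc _ ≤ ∑' u, X u * C := ENNReal.tsum_le_tsum fun u => mul_le_mul_right (hCn _) _
        _ = (∑' u, X u) * C := ENNReal.tsum_mul_right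
        _ ≤ _ := mul_le_mul_left hX _
    refine ne_top_of_le_ne_top ?_ this
    finiteness
  have hle : ∀ v : {v : Vec5 // IsIsotropic v}, ENNReal.ofReal (height v.1 ^ (-4 : ℝ)) ≤ Y v.1 := by
    rintro ⟨⟨⟨p, q, r⟩, a, d⟩, hv⟩
    simp only [IsIsotropic] at hv
    set t := height ((p, q, r), a, d) with ht
    have ht0 : 0 < t := one_pos.trans_le (one_le_height _)
    have ha0 := abs_nonneg (p : ℝ); have hb0 := abs_nonneg (q : ℝ)
    have hc0 := abs_nonneg (r : ℝ); have hd0 := abs_nonneg (a : ℝ)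
    have he0 := abs_nonneg (d : ℝ)
    have hp : 1 + |(p : ℝ)| ≤ t := by simp only [ht, height]; linarith
    have hq : 1 + |(q : ℝ)| ≤ t := by simp only [ht, height]; linarith
    have hr : 1 + |(r : ℝ)| ≤ t := by simp only [ht, height]; linarith
    have ha : 1 + |(a : ℝ)| ≤ t := by simp only [ht, height]; linarith
    have hd : 1 + |(d : ℝ)| ≤ t := by simp only [ht, height]; linarith
    -- The exponent budget: t^(-4) may be split into weights of total exponent at most 4.
    have key : ∀ e : ℝ, e ≤ 4 → ENNReal.ofReal (t ^ (-4 : ℝ)) ≤ ENNReal.ofReal (t ^ (-e)) :=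
      fun e he => ENNReal.ofReal_le_ofReal
        (Real.rpow_le_rpow_of_exponent_le (one_le_height _) (by linarith))
    have h109 : (0 : ℝ) ≤ 10 / 9 := by norm_num
    have h13 : (0 : ℝ) ≤ 1 / 3 := by norm_num
    by_cases hn : p * r - q ^ 2 = 0
    · have hpr : p * r = q ^ 2 := by linarith
      have e1 : factorWgt (p * r - q ^ 2) (a, d) = wgt (10 / 9) a * wgt (10 / 9) d := by
        simp [factorWgt, hv, hn]
      have had : a = 0 ∨ d = 0 := by rw [hn] at hv; exact mul_eq_zero.1 hv
      -- One of a, d vanishes and has weight 1, so only the other one consumes an exponent.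
      have e2 : ENNReal.ofReal (t ^ (-(10 / 9) : ℝ)) ≤ wgt (10 / 9) a * wgt (10 / 9) d := by
        rcases had with h | h
        · subst h; simpa [wgt] using le_wgt h109 hd
        · subst h; simpa [wgt] using le_wgt h109 ha
      have e3 : ENNReal.ofReal (t ^ (-(10 / 9) : ℝ)) ≤ factorWgt (q ^ 2) (p, r) := by
        by_cases hq0 : q ^ 2 = 0
        · have : p = 0 ∨ r = 0 := by rw [hq0] at hpr; exact mul_eq_zero.1 hpr
          simp only [factorWgt, hpr, hq0, if_true]
          rcases this with h | h
          · subst h; simpa [wgt] using le_wgt h109 hr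
          · subst h; simpa [wgt] using le_wgt h109 hp
        · simp only [factorWgt, hpr, hq0, if_true, if_false]
          calc _ ≤ ENNReal.ofReal (t ^ (-(1 / 3 + 1 / 3) : ℝ)) :=
                ENNReal.ofReal_le_ofReal
                  (Real.rpow_le_rpow_of_exponent_le (one_le_height _) (by norm_num))
            _ = _ := ofReal_rpow_add ht0
            _ ≤ _ := mul_le_mul' (le_wgt h13 hp) (le_wgt h13 hr)
      -- The degenerate case costs 10/9 each for q, for (p, r) and for (a, d), in total 10/3.
      calc _ ≤ ENNReal.ofReal (t ^ (-((10 / 9 + 10 / 9) + 10 / 9) : ℝ)) := key _ (by norm_num)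
        _ = _ := by rw [ofReal_rpow_add ht0, ofReal_rpow_add ht0]
        _ ≤ (wgt (10 / 9) q * factorWgt (q ^ 2) (p, r)) * (wgt (10 / 9) a * wgt (10 / 9) d) :=
            mul_le_mul' (mul_le_mul' (le_wgt h109 hq) e3) e2
        _ ≤ Y ((p, q, r), a, d) := by
            simp only [Y, e1]
            exact mul_le_mul_left le_add_self _
    · have e1 : factorWgt (p * r - q ^ 2) (a, d) = wgt (1 / 3) a * wgt (1 / 3) d := by
        simp [factorWgt, hv, hn]
      -- Here 3 · 10/9 + 2 · 1/3 = 4 uses the whole budget, which explains the value 10/9.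
      calc _ ≤ ENNReal.ofReal (t ^ (-((10 / 9 + (10 / 9 + 10 / 9)) + (1 / 3 + 1 / 3)) : ℝ)) :=
            key _ (by norm_num)
        _ = _ := by
            rw [ofReal_rpow_add ht0, ofReal_rpow_add ht0, ofReal_rpow_add ht0, ofReal_rpow_add ht0]
        _ ≤ (wgt (10 / 9) p * (wgt (10 / 9) q * wgt (10 / 9) r)) *
              (wgt (1 / 3) a * wgt (1 / 3) d) :=
            mul_le_mul' (mul_le_mul' (le_wgt h109 hp) (mul_le_mul' (le_wgt h109 hq)
              (le_wgt h109 hr))) (mul_le_mul' (le_wgt h13 ha) (le_wgt h13 hd))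
        _ ≤ Y ((p, q, r), a, d) := by
            simp only [Y, e1]
            exact mul_le_mul_left le_self_add _
  have hsum : ∑' v : {v : Vec5 // IsIsotropic v}, ENNReal.ofReal (height v.1 ^ (-4 : ℝ)) ≠ ⊤ := by
    refine ne_top_of_le_ne_top hY ((ENNReal.tsum_le_tsum hle).trans ?_)
    exact ENNReal.tsum_comp_le_tsum_of_injective Subtype.val_injective Y
  have := ENNReal.summable_toReal hsum
  refine this.congr fun v => ENNReal.toReal_ofReal ?_
  exact Real.rpow_nonneg (zero_le_one.trans (one_le_height _)) _

/-! ### The linear form attached to an isotropic vector -/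

/-- The function `a det Z + r τ + p τ' + 2 q z + d` in the coordinates `(τ, z, τ')`. -/
def lform (v : Vec5) (x : ℂ × ℂ × ℂ) : ℂ :=
  v.2.1 * (x.1 * x.2.2 - x.2.1 ^ 2) + v.1.2.2 * x.1 + v.1.1 * x.2.2 + 2 * v.1.2.1 * x.2.1 + v.2.2

/-- The determinant of the imaginary part in the coordinates `(τ, z, τ')`. -/
def imDet (x : ℂ × ℂ × ℂ) : ℝ := x.1.im * x.2.2.im - x.2.1.im ^ 2

/-- The Siegel upper half space in the coordinates `(τ, z, τ')`. -/
def halfSpaceCoords : Set (ℂ × ℂ × ℂ) := {x | 0 < x.1.im ∧ 0 < imDet x}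

/-- The part of the half space where `|X| ≤ B` entrywise and `Y ≥ c`. -/
def strip (c B : ℝ) : Set (ℂ × ℂ × ℂ) :=
  {x | (|x.1.re| ≤ B ∧ |x.2.1.re| ≤ B ∧ |x.2.2.re| ≤ B) ∧
    c ≤ x.1.im ∧ c ≤ x.2.2.im ∧ x.2.1.im ^ 2 ≤ (x.1.im - c) * (x.2.2.im - c)}

lemma det_imPart_ofCoords (x : ℂ × ℂ × ℂ) : (imPart (ofCoords x)).det = imDet x := by
  simp [imPart, ofCoords, det_fin_two, imDet, sq]

lemma posDef_fin_two {Y : Matrix (Fin 2) (Fin 2) ℝ} (hs : Y 1 0 = Y 0 1) :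
    Y.PosDef ↔ 0 < Y 0 0 ∧ 0 < Y.det := by
  constructor
  · intro h
    exact ⟨h.diag_pos, h.det_pos⟩
  · rintro ⟨h1, h2⟩
    rw [det_fin_two] at h2
    refine Matrix.PosDef.of_dotProduct_mulVec_pos ?_ ?_
    · ext i j
      fin_cases i <;> fin_cases j <;> simp [hs]
    · intro u hu
      have hu' : u 0 ≠ 0 ∨ u 1 ≠ 0 := by
        by_contra hcon
        push Not at hcon
        exact hu (by ext i; fin_cases i <;> simp [hcon])
      simp only [dotProduct, mulVec, Fin.sum_univ_two, star_trivial]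
      have key : Y 0 0 * (u 0 * (Y 0 0 * u 0 + Y 0 1 * u 1) + u 1 * (Y 1 0 * u 0 + Y 1 1 * u 1)) =
          (Y 0 0 * u 0 + Y 0 1 * u 1) ^ 2 + (Y 0 0 * Y 1 1 - Y 0 1 * Y 1 0) * u 1 ^ 2 := by
        rw [hs]; ring
      refine pos_of_mul_pos_right (a := Y 0 0) ?_ h1.le
      rw [key]
      rcases eq_or_ne (u 1) 0 with h | h
      · have : u 0 ≠ 0 := by simpa [h] using hu'
        rw [h]; simp; positivity
      · positivity

lemma ofCoords_mem_siegelHalfSpace (x : ℂ × ℂ × ℂ) :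
    ofCoords x ∈ siegelHalfSpace ↔ x ∈ halfSpaceCoords := by
  have hs : (ofCoords x).IsSymm := by
    ext i j; fin_cases i <;> fin_cases j <;> simp [ofCoords]
  simp only [siegelHalfSpace, Set.mem_ofPred_eq, hs, true_and, halfSpaceCoords]
  rw [posDef_fin_two (by simp [imPart, ofCoords]), det_imPart_ofCoords]
  simp [imPart, ofCoords]

lemma exists_ofCoords {Z : Mat2} (hZ : Z ∈ siegelHalfSpace) :
    ∃ x ∈ halfSpaceCoords, Z = ofCoords x := by
  have hs := hZ.1.apply 0 1
  have : Z = ofCoords (Z 0 0, Z 0 1, Z 1 1) := by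
    ext i j; fin_cases i <;> fin_cases j <;> simp [ofCoords, hs]
  refine ⟨_, ?_, this⟩
  rw [← ofCoords_mem_siegelHalfSpace, ← this]
  exact hZ

/-- The quotient det Y / tr Y is a lower bound for the smallest eigenvalue of Y, so it serves as c.
-/
lemma exists_mem_strip {x : ℂ × ℂ × ℂ} (hx : x ∈ halfSpaceCoords) :
    ∃ c B, 0 < c ∧ x ∈ strip c B := by
  obtain ⟨h1, h2⟩ := hx
  simp only [imDet] at h2
  have h3 : 0 < x.2.2.im := by
    refine pos_of_mul_pos_right (a := x.1.im) ?_ h1.le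
    nlinarith [sq_nonneg x.2.1.im]
  set y1 := x.1.im
  set y2 := x.2.1.im
  set y3 := x.2.2.im
  have h4 : 0 < y1 + y3 := by positivity
  refine ⟨(y1 * y3 - y2 ^ 2) / (y1 + y3), |x.1.re| + |x.2.1.re| + |x.2.2.re|, by positivity,
    ⟨?_, ?_, ?_⟩, ?_, ?_, ?_⟩
  · nlinarith [abs_nonneg x.2.1.re, abs_nonneg x.2.2.re]
  · nlinarith [abs_nonneg x.1.re, abs_nonneg x.2.2.re]
  · nlinarith [abs_nonneg x.1.re, abs_nonneg x.2.1.re]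
  · rw [div_le_iff₀ h4]
    nlinarith [sq_nonneg y2, sq_nonneg y1]
  · rw [div_le_iff₀ h4]
    nlinarith [sq_nonneg y2, sq_nonneg y3]
  · have : (y1 - (y1 * y3 - y2 ^ 2) / (y1 + y3)) * (y3 - (y1 * y3 - y2 ^ 2) / (y1 + y3)) =
        y2 ^ 2 + ((y1 * y3 - y2 ^ 2) / (y1 + y3)) ^ 2 := by
      field_simp; ring
    rw [this]
    nlinarith [sq_nonneg ((y1 * y3 - y2 ^ 2) / (y1 + y3))]

/-! ### Bounding an isotropic vector by its linear form -/

/-- The hypotheses combine to 4c²(p² + q²) ≤ l² + 4c|p|l, that is, (2c|p| - l)² + 4c²q² ≤ 2l². The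
identity `h` is stated abstractly so that it applies to (p, q) and, after exchanging y1 and y3, to
(r, q). -/
lemma abs_le_of_quadratic {c y1 y2 y3 p q T l D : ℝ} (hc : 0 < c) (hD : 0 < D) (hl : 0 ≤ l)
    (hy1 : c * y1 ≤ D) (hy : c ≤ y1)
    (hform : c * (p ^ 2 + q ^ 2) ≤ p ^ 2 * y3 + 2 * p * q * y2 + q ^ 2 * y1)
    (hT : T ^ 2 ≤ l ^ 2) {e : ℝ} (he : e ≤ l ^ 2)
    (h : 4 * D * (p ^ 2 * y3 + 2 * p * q * y2 + q ^ 2 * y1) = y1 * e - y1 * T ^ 2 + 4 * D * p * T) :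
    |p| ≤ 2 * l / c ∧ |q| ≤ 2 * l / c := by
  have h1 : 4 * D * (c * (p ^ 2 + q ^ 2)) ≤ y1 * l ^ 2 + 4 * D * (|p| * l) := by
    have e1 : p * T ≤ |p| * l := by
      refine (le_abs_self _).trans ?_
      rw [abs_mul]
      exact mul_le_mul_of_nonneg_left (abs_le_of_sq_le_sq hT hl) (abs_nonneg _)
    have e2 : y1 * e ≤ y1 * l ^ 2 := mul_le_mul_of_nonneg_left he (hc.le.trans hy)
    have e3 : 0 ≤ y1 * T ^ 2 := mul_nonneg (hc.le.trans hy) (sq_nonneg _)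
    have e4 := mul_le_mul_of_nonneg_left hform (by positivity : 0 ≤ 4 * D)
    have e5 := mul_le_mul_of_nonneg_left e1 (by positivity : 0 ≤ 4 * D)
    nlinarith
  have h2 : c * (4 * D * (c * (p ^ 2 + q ^ 2))) ≤ D * l ^ 2 + c * (4 * D * (|p| * l)) := by
    have := mul_le_mul_of_nonneg_left h1 hc.le
    have := mul_le_mul_of_nonneg_right hy1 (sq_nonneg l)
    nlinarith
  have h3 : 4 * c ^ 2 * (p ^ 2 + q ^ 2) ≤ l ^ 2 + 4 * c * |p| * l := by
    refine le_of_mul_le_mul_left ?_ hD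
    nlinarith
  have hp2 : p ^ 2 = |p| ^ 2 := (sq_abs p).symm
  have hq2 : q ^ 2 = |q| ^ 2 := (sq_abs q).symm
  rw [hp2, hq2] at h3
  have hp := abs_nonneg p
  have hq := abs_nonneg q
  constructor
  · rw [le_div_iff₀ hc]
    by_contra hcon
    push Not at hcon
    nlinarith [sq_nonneg (c * |q|)]
  · rw [le_div_iff₀ hc]
    refine (sq_le_sq₀ (by positivity) (by positivity)).1 ?_
    nlinarith [sq_nonneg (2 * c * |p| - l)]

/-- The case X = 0. Isotropy turns (d - aD)² into (d + aD)² - 4(pr - q²)D, so l² is also the sum of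
(d + aD)² and the discriminant T² - 4(pr - q²)D. The latter is nonnegative because Y is positive
definite, hence all of these quantities are bounded by l². -/
lemma abs_le_of_isotropic {c y1 y2 y3 p q r a d l : ℝ} (hc : 0 < c) (hl : 0 ≤ l)
    (h1 : c ≤ y1) (h3 : c ≤ y3) (h2 : y2 ^ 2 ≤ (y1 - c) * (y3 - c))
    (hv : a * d = p * r - q ^ 2)
    (h : (d - a * (y1 * y3 - y2 ^ 2)) ^ 2 + (p * y3 + r * y1 + 2 * q * y2) ^ 2 = l ^ 2) :
    (|p| ≤ 2 * l / c ∧ |q| ≤ 2 * l / c ∧ |r| ≤ 2 * l / c) ∧ |a| ≤ l / c ^ 2 ∧ |d| ≤ l := by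
  set D := y1 * y3 - y2 ^ 2 with hD
  set T := p * y3 + r * y1 + 2 * q * y2 with hT
  -- The condition on y2 gives D ≥ y1 y3 - (y1 - c)(y3 - c) = c(y1 + y3 - c).
  have hD1 : c * y1 ≤ D := by nlinarith
  have hD3 : c * y3 ≤ D := by nlinarith
  have hDc : c ^ 2 ≤ D := by nlinarith
  have hD0 : 0 < D := lt_of_lt_of_le (by positivity) hDc
  have hT2 : T ^ 2 ≤ l ^ 2 := by nlinarith [sq_nonneg (d - a * D)]
  have hR2 : (d - a * D) ^ 2 ≤ l ^ 2 := by nlinarith [sq_nonneg T]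
  have hdisc : T ^ 2 - 4 * (p * r - q ^ 2) * D + (d + a * D) ^ 2 = l ^ 2 := by
    rw [← h, ← hv]; ring
  have hsq : ∀ x y : ℝ, c * (x ^ 2 + y ^ 2) ≤ x ^ 2 * y3 + 2 * x * y * y2 + y ^ 2 * y1 := by
    intro x y
    rcases (sub_nonneg.2 h1).eq_or_lt with h0 | h0
    · have hy2 : y2 = 0 := by
        rw [← h0, zero_mul] at h2
        exact pow_eq_zero_iff two_ne_zero |>.1 (le_antisymm h2 (sq_nonneg _))
      rw [hy2]
      nlinarith [sq_nonneg x, sq_nonneg y]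
    · have : 0 ≤ (y1 - c) * (x ^ 2 * (y3 - c) + 2 * x * y * y2 + y ^ 2 * (y1 - c)) := by
        nlinarith [sq_nonneg ((y1 - c) * y + y2 * x), mul_le_mul_of_nonneg_left h2 (sq_nonneg x)]
      have := nonneg_of_mul_nonneg_right this h0
      linarith
  -- This is the discriminant of a pencil of binary quadratic forms containing a definite one, whose
  -- roots are real; multiplied by y1² it is a sum of squares.
  have hdisc0 : 0 ≤ T ^ 2 - 4 * (p * r - q ^ 2) * D := by
    have e : y1 ^ 2 * (T ^ 2 - 4 * (p * r - q ^ 2) * D) =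
        (y1 * T - 2 * D * p) ^ 2 + 4 * D * (p * y2 + q * y1) ^ 2 := by
      rw [hT, hD]; ring
    have : 0 < y1 := hc.trans_le h1
    refine nonneg_of_mul_nonneg_right (a := y1 ^ 2) ?_ (by positivity)
    rw [e]; positivity
  have hS2 : (d + a * D) ^ 2 ≤ l ^ 2 := by linarith
  have he : T ^ 2 - 4 * (p * r - q ^ 2) * D ≤ l ^ 2 := by nlinarith [sq_nonneg (d + a * D)]
  obtain ⟨b1, b2⟩ := abs_le_of_quadratic (p := p) (q := q) hc hD0 hl hD1 h1 (hsq p q) hT2 he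
    (by rw [hT, hD]; ring)
  obtain ⟨b3, -⟩ := abs_le_of_quadratic (p := r) (q := q) (y1 := y3) (y2 := y2) (y3 := y1) hc hD0
    hl hD3 h3 (by linarith [hsq q r]) hT2 he (by rw [hT, hD]; ring)
  have f1 := abs_le.1 (abs_le_of_sq_le_sq hR2 hl)
  have f2 := abs_le.1 (abs_le_of_sq_le_sq hS2 hl)
  refine ⟨⟨b1, b2, b3⟩, ?_, ?_⟩
  · rw [le_div_iff₀ (by positivity)]
    calc |a| * c ^ 2 ≤ |a| * D := by gcongr
      _ = |a * D| := by rw [abs_mul, abs_of_pos hD0]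
      _ ≤ l := abs_le.2 ⟨by linarith, by linarith⟩
  · exact abs_le.2 ⟨by linarith, by linarith⟩

/-- A nonzero integral vector has ℓ¹-norm at least 1, which absorbs the summand 1 in the height. -/
lemma one_add_height_le {v : Vec5} (hv : v ≠ 0) : height v ≤ 2 * (height v - 1) := by
  have h1 : (1 : ℝ) ≤ height v - 1 := by
    have : (1 : ℤ) ≤ |v.1.1| + |v.1.2.1| + |v.1.2.2| + |v.2.1| + |v.2.2| := by
      by_contra hcon
      apply hv
      have := abs_nonneg v.1.1; have := abs_nonneg v.1.2.1; have := abs_nonneg v.1.2.2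
      have := abs_nonneg v.2.1; have := abs_nonneg v.2.2
      refine Prod.ext (Prod.ext ?_ (Prod.ext ?_ ?_)) (Prod.ext ?_ ?_) <;>
        exact abs_eq_zero.1 (by omega)
    have h2 : ((1 : ℤ) : ℝ) ≤ ((|v.1.1| + |v.1.2.1| + |v.1.2.2| + |v.2.1| + |v.2.2| : ℤ) : ℝ) :=
      by exact_mod_cast this
    push_cast at h2
    unfold height
    linarith
  linarith

/-- On `strip c B`, the linear form of an isotropic vector is bounded below by the height. -/
theorem exists_height_le {c B : ℝ} (hc : 0 < c) :
    ∃ K, 0 < K ∧ ∀ v : Vec5, IsIsotropic v → v ≠ 0 → ∀ x ∈ strip c B,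
      height v ≤ K * ‖lform v x‖ := by
  set K1 := 2 / c + |B| * (1 / c ^ 2) with hK1
  have hK1p : 0 < K1 := by positivity
  set K2 := 1 + (1 / c ^ 2) * (2 * |B| ^ 2) + 4 * K1 * |B| with hK2
  have hK2p : 0 < K2 := by positivity
  refine ⟨2 * (3 * K1 + 1 / c ^ 2 + K2), by positivity, ?_⟩
  rintro v hv hv0 ⟨x1, x2, x3⟩ ⟨⟨hx1, hx2, hx3⟩, hy1, hy3, hy2⟩
  simp only at hx1 hx2 hx3 hy1 hy2 hy3
  have hx1 := hx1.trans (le_abs_self B)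
  have hx2 := hx2.trans (le_abs_self B)
  have hx3 := hx3.trans (le_abs_self B)
  refine (one_add_height_le hv0).trans ?_
  rw [mul_assoc]
  refine mul_le_mul_of_nonneg_left ?_ (by norm_num)
  obtain ⟨⟨p, q, r⟩, a, d⟩ := v
  simp only [IsIsotropic] at hv
  have hv' : (a : ℝ) * d = p * r - (q : ℝ) ^ 2 := by exact_mod_cast hv
  set l := ‖lform ((p, q, r), a, d) (x1, x2, x3)‖ with hl
  have hl0 : 0 ≤ l := norm_nonneg _
  have hre : (lform ((p, q, r), a, d) (x1, x2, x3)).re =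
      (d + a * (x1.re * x3.re - x2.re ^ 2) + r * x1.re + p * x3.re + 2 * q * x2.re) -
        a * (x1.im * x3.im - x2.im ^ 2) := by
    simp [lform, sq]; ring
  have him : (lform ((p, q, r), a, d) (x1, x2, x3)).im =
      (p + a * x1.re) * x3.im + (r + a * x3.re) * x1.im + 2 * (q - a * x2.re) * x2.im := by
    simp [lform, sq]; ring
  have hl2 := Complex.sq_norm (lform ((p, q, r), a, d) (x1, x2, x3))
  rw [Complex.normSq_apply, ← hl, ← sq, ← sq, hre, him] at hl2
  obtain ⟨⟨b1, b2, b3⟩, b4, b5⟩ := abs_le_of_isotropic hc hl0 hy1 hy3 hy2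
    (by linear_combination hv') hl2.symm
  have b4' : |(a : ℝ)| ≤ 1 / c ^ 2 * l := by rw [one_div_mul_eq_div]; exact b4
  -- Translation by X replaces p, q, r by p + a x1, q - a x2, r + a x3 (real parts of the
  -- coordinates) and keeps the vector isotropic. The bound for X = 0 controls a itself, so the
  -- shifts can be undone. Absolute values of B are used since B may be negative.
  have hshift : ∀ m n X : ℝ, |X| ≤ |B| → m = n + a * X ∨ m = n - a * X → |m| ≤ 2 * l / c →
      |n| ≤ K1 * l := by
    intro m n X hX hm hb
    have h1 : |a * X| ≤ (1 / c ^ 2 * l) * |B| := by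
      rw [abs_mul]; exact mul_le_mul b4' hX (abs_nonneg _) (by positivity)
    have h2 : |n| ≤ |m| + |a * X| := by
      rcases hm with rfl | rfl
      · have := abs_sub (n + a * X) (a * X)
        simpa using this
      · have := abs_add_le (n - a * X) (a * X)
        simpa using this
    calc |n| ≤ 2 * l / c + (1 / c ^ 2 * l) * |B| := by linarith
      _ = K1 * l := by rw [hK1]; ring
  have c1 := hshift _ _ _ hx1 (Or.inl rfl) b1
  have c2 := hshift _ _ _ hx2 (Or.inr rfl) b2
  have c3 := hshift _ _ _ hx3 (Or.inl rfl) b3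
  have c4 : |(d : ℝ)| ≤ K2 * l := by
    have e1 : |a * (x1.re * x3.re - x2.re ^ 2)| ≤ (1 / c ^ 2 * l) * (2 * |B| ^ 2) := by
      rw [abs_mul]
      refine mul_le_mul b4' ?_ (abs_nonneg _) (by positivity)
      refine (abs_sub _ _).trans ?_
      rw [abs_mul, abs_pow]
      have i1 := mul_le_mul hx1 hx3 (abs_nonneg _) (abs_nonneg _)
      have i2 := pow_le_pow_left₀ (abs_nonneg _) hx2 2
      rw [← sq] at i1
      linarith
    have e2 : |r * x1.re| ≤ K1 * l * |B| := by
      rw [abs_mul]; exact mul_le_mul c3 hx1 (abs_nonneg _) (by positivity)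
    have e3 : |p * x3.re| ≤ K1 * l * |B| := by
      rw [abs_mul]; exact mul_le_mul c1 hx3 (abs_nonneg _) (by positivity)
    have e4 : |q * x2.re| ≤ K1 * l * |B| := by
      rw [abs_mul]; exact mul_le_mul c2 hx2 (abs_nonneg _) (by positivity)
    have : K2 * l = l + (1 / c ^ 2 * l) * (2 * |B| ^ 2) + 4 * (K1 * l * |B|) := by rw [hK2]; ring
    rw [this]
    have g1 := abs_le.1 e1; have g2 := abs_le.1 e2; have g3 := abs_le.1 e3
    have g4 := abs_le.1 e4; have g5 := abs_le.1 b5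
    exact abs_le.2 ⟨by linarith, by linarith⟩
  simp only [height]
  calc _ ≤ K1 * l + K1 * l + K1 * l + 1 / c ^ 2 * l + K2 * l := by linarith
    _ = _ := by ring

lemma lform_ne_zero {v : Vec5} (hv : IsIsotropic v) (hv0 : v ≠ 0) {x : ℂ × ℂ × ℂ}
    (hx : x ∈ halfSpaceCoords) : lform v x ≠ 0 := by
  obtain ⟨c, B, hc, hx⟩ := exists_mem_strip hx
  obtain ⟨K, -, hK⟩ := exists_height_le (B := B) hc
  intro h
  have := (one_le_height v).trans (hK v hv hv0 x hx)
  rw [h] at this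
  norm_num at this

/-! ### Symplectic matrices and their minors -/

/-- The standard symplectic form on `ℤ ^ 4`. -/
def sympForm (u v : Fin 4 → ℤ) : ℤ := u 0 * v 2 + u 1 * v 3 - u 2 * v 0 - u 3 * v 1

/-- If `u ∧ v = u' ∧ v'` is nonzero and `u, v` span an isotropic plane, then `u'` is orthogonal to
this plane. -/
lemma sympForm_eq_zero {u v u' v' : Fin 4 → ℤ}
    (h : ∀ i j, u i * v j - u j * v i = u' i * v' j - u' j * v' i)
    (huv : sympForm u v = 0) (hne : ∃ i j, u i * v j - u j * v i ≠ 0) :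
    sympForm u u' = 0 ∧ sympForm v u' = 0 := by
  -- The coordinates of u ∧ v ∧ u' = u' ∧ v' ∧ u' = 0.
  have hT : ∀ i j k, (u i * v j - u j * v i) * u' k - (u i * v k - u k * v i) * u' j +
      (u j * v k - u k * v j) * u' i = 0 := by
    intro i j k
    rw [h i j, h i k, h j k]; ring
  -- Contraction of this trivector with the symplectic form; the term with ω(u, v) drops out. Linear
  -- independence of u and v then finishes the proof.
  have hX : ∀ k, sympForm v u' * u k = sympForm u u' * v k := by
    intro k
    have h1 := hT 0 2 k
    have h2 := hT 1 3 k
    simp only [sympForm] at huv ⊢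
    linear_combination h1 + h2 - u' k * huv
  obtain ⟨i, j, hij⟩ := hne
  constructor
  · refine (mul_eq_zero.1 (?_ : sympForm u u' * (u i * v j - u j * v i) = 0)).resolve_right hij
    linear_combination u j * hX i - u i * hX j
  · refine (mul_eq_zero.1 (?_ : sympForm v u' * (u i * v j - u j * v i) = 0)).resolve_right hij
    linear_combination v j * hX i - v i * hX j

/-- The rows of `(C D)`. -/
def lowerRow (M : Gam) (i : Fin 2) : Fin 4 → ℤ :=
  ![M.1 (Sum.inr i) (Sum.inl 0), M.1 (Sum.inr i) (Sum.inl 1),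
    M.1 (Sum.inr i) (Sum.inr 0), M.1 (Sum.inr i) (Sum.inr 1)]

/-- The rows of `(A B)`. -/
def upperRow (M : Gam) (i : Fin 2) : Fin 4 → ℤ :=
  ![M.1 (Sum.inl i) (Sum.inl 0), M.1 (Sum.inl i) (Sum.inl 1),
    M.1 (Sum.inl i) (Sum.inr 0), M.1 (Sum.inl i) (Sum.inr 1)]

lemma sympForm_lowerRow (M : Gam) (i j : Fin 2) :
    sympForm (lowerRow M i) (lowerRow M j) = 0 := by
  have h := congrFun (congrFun (SymplecticGroup.mem_iff.1 M.2) (Sum.inr i)) (Sum.inr j)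
  simp [Matrix.mul_apply, Matrix.J, Fin.sum_univ_two, Matrix.one_apply, fromBlocks] at h
  simp [sympForm, lowerRow]
  linarith

lemma sympForm_upperRow_lowerRow (M : Gam) (i j : Fin 2) :
    sympForm (upperRow M i) (lowerRow M j) = if i = j then 1 else 0 := by
  have h := congrFun (congrFun (SymplecticGroup.mem_iff.1 M.2) (Sum.inl i)) (Sum.inr j)
  simp [Matrix.mul_apply, Matrix.J, Fin.sum_univ_two, Matrix.one_apply, fromBlocks] at h
  simp [sympForm, lowerRow, upperRow]
  split_ifs at h ⊢ <;> linarith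

/-- The `2 × 2` minor of `(C D)` in the columns `i, j`. -/
def minor (M : Gam) (i j : Fin 4) : ℤ :=
  lowerRow M 0 i * lowerRow M 1 j - lowerRow M 0 j * lowerRow M 1 i

/-- If the two lower rows had zero wedge product, contraction with the first upper row would give
that the second lower row is 0, contradicting its pairing 1 with the second upper row. -/
lemma exists_minor_ne_zero (M : Gam) : ∃ i j, minor M i j ≠ 0 := by
  by_contra hcon
  push Not at hcon
  simp only [minor] at hcon
  have h1 := sympForm_upperRow_lowerRow M 0 0
  have h2 := sympForm_upperRow_lowerRow M 0 1
  have h3 := sympForm_upperRow_lowerRow M 1 1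
  have hv : ∀ j, lowerRow M 1 j = 0 := by
    intro j
    simp only [sympForm] at h1 h2
    norm_num at h1 h2
    linear_combination (-lowerRow M 1 j) * h1 + (lowerRow M 0 j) * h2 +
      upperRow M 0 0 * hcon 2 j + upperRow M 0 1 * hcon 3 j - upperRow M 0 2 * hcon 0 j
        - upperRow M 0 3 * hcon 1 j
  simp [sympForm, hv] at h3

/-- The vector of minors of `(C D)`. -/
def minors (M : Gam) : Vec5 :=
  ((minor M 2 1, minor M 1 3, minor M 0 3), (minor M 0 1, minor M 2 3))

lemma minor_zero_two (M : Gam) : minor M 0 2 = -minor M 1 3 := by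
  have := sympForm_lowerRow M 0 1
  simp only [sympForm] at this
  simp only [minor]
  linarith

lemma minor_swap (M : Gam) (i j : Fin 4) : minor M j i = -minor M i j := by
  simp only [minor]; ring

lemma minor_eq_of_minors_eq {M N : Gam} (h : minors M = minors N) (i j : Fin 4) :
    minor M i j = minor N i j := by
  simp only [minors, Prod.mk.injEq] at h
  obtain ⟨⟨h1, h2, h3⟩, h4, h5⟩ := h
  have h6 := minor_zero_two M
  have h7 := minor_zero_two N
  have hM := minor_swap M
  have hN := minor_swap N
  have hM0 : ∀ i, minor M i i = 0 := fun i => by simp only [minor]; ring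
  have hN0 : ∀ i, minor N i i = 0 := fun i => by simp only [minor]; ring
  have h8 := hM 1 2
  have h9 := hN 1 2
  fin_cases i <;> fin_cases j <;> simp only [Fin.zero_eta, Fin.mk_one, Fin.reduceFinMk] <;>
    first
      | rw [hM0, hN0]
      | omega
      | (rw [hM, hN]; omega)

lemma minors_ne_zero (M : Gam) : minors M ≠ 0 := by
  intro h
  obtain ⟨i, j, hij⟩ := exists_minor_ne_zero M
  simp only [minors, Prod.ext_iff, Prod.fst_zero, Prod.snd_zero] at h
  obtain ⟨⟨h1, h2, h3⟩, h4, h5⟩ := h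
  apply hij
  have h6 := minor_zero_two M
  have hM := minor_swap M
  have hM0 : ∀ i, minor M i i = 0 := fun i => by simp only [minor]; ring
  have h8 := hM 1 2
  fin_cases i <;> fin_cases j <;> simp only [Fin.zero_eta, Fin.mk_one, Fin.reduceFinMk] <;>
    first
      | rw [hM0]
      | omega
      | (rw [hM]; omega)

/-- The Plücker relation, with one of the six minors eliminated by the Lagrangian condition
`minor_zero_two`. -/
lemma isIsotropic_minors (M : Gam) : IsIsotropic (minors M) := by
  have h := minor_zero_two M
  simp only [IsIsotropic, minors]
  have : minor M 0 1 * minor M 2 3 - minor M 0 2 * minor M 1 3 + minor M 0 3 * minor M 1 2 = 0 := by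
    simp only [minor]; ring
  rw [h, minor_swap M 2 1] at this
  linarith

lemma toBlocks₁₁_inv (M : Gam) : (M⁻¹ : Gam).1.toBlocks₁₁ = (M.1.toBlocks₂₂)ᵀ := by
  rw [SymplecticGroup.coe_inv]
  conv_lhs => rw [← fromBlocks_toBlocks M.1]
  simp [Matrix.J, fromBlocks_transpose, fromBlocks_multiply, Matrix.fromBlocks_neg]

/-- The vector of minors determines the coset `Γ_∞ M`. -/
lemma rightRel_of_minors_eq {M N : Gam} (h : minors M = minors N) :
    QuotientGroup.rightRel gamInfty M N := by
  rw [QuotientGroup.rightRel_apply]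
  change (N * M⁻¹ : Gam).1.toBlocks₂₁ = 0
  rw [Submonoid.coe_mul, toBlocks₂₁_mul, toBlocks₁₁_inv, toBlocks₂₁_inv]
  have hm := minor_eq_of_minors_eq h
  -- Up to sign, the entries of the lower left block of N M⁻¹ are the pairings of rows of M and N.
  -- The pair (N₁, -N₀) has the same wedge product as (N₀, N₁), so the same lemma handles the second
  -- row of N.
  have key : ∀ i j, sympForm (lowerRow M i) (lowerRow N j) = 0 := by
    have h0 := sympForm_eq_zero (u := lowerRow M 0) (v := lowerRow M 1) (u' := lowerRow N 0)
      (v' := lowerRow N 1) (fun i j => hm i j) (sympForm_lowerRow M 0 1) (exists_minor_ne_zero M)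
    have h1 := sympForm_eq_zero (u := lowerRow M 0) (v := lowerRow M 1) (u' := lowerRow N 1)
      (v' := -lowerRow N 0)
      (fun i j => by
        have := hm i j
        simp only [minor] at this
        simp only [Pi.neg_apply]
        linarith)
      (sympForm_lowerRow M 0 1) (exists_minor_ne_zero M)
    intro i j
    fin_cases i <;> fin_cases j
    exacts [h0.1, h1.1, h0.2, h1.2]
  ext i j
  have := key j i
  simp [sympForm, lowerRow] at this
  simp [Matrix.mul_apply, Fin.sum_univ_two, toBlocks₂₁, toBlocks₂₂]
  linarith

lemma minors_out_injective : Function.Injective fun q : Cosets => minors q.out := by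
  intro q q' h
  rw [← Quotient.out_eq q, ← Quotient.out_eq q']
  exact Quotient.sound (rightRel_of_minors_eq h)

lemma det_blkC_mul_add (M : Gam) (x : ℂ × ℂ × ℂ) :
    (blkC M * ofCoords x + blkD M).det = lform (minors M) x := by
  have h : (minor M 0 2 : ℂ) = -minor M 1 3 := by exact_mod_cast minor_zero_two M
  have h2 : lform (minors M) x = (minor M 0 1 : ℂ) * (x.1 * x.2.2 - x.2.1 ^ 2) +
      minor M 0 3 * x.1 + minor M 2 1 * x.2.2 + (minor M 1 3 - minor M 0 2) * x.2.1
      + minor M 2 3 := by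
    rw [h]; simp only [lform, minors]; ring
  rw [h2, det_fin_two]
  simp [blkC, blkD, ofCoords, minor, lowerRow, toBlocks₂₁, toBlocks₂₂, Matrix.mul_apply,
    Fin.sum_univ_two]
  ring

lemma det_denom_ne_zero (M : Gam) {Z : Mat2} (hZ : Z ∈ siegelHalfSpace) :
    (blkC M * Z + blkD M).det ≠ 0 := by
  obtain ⟨x, hx, rfl⟩ := exists_ofCoords hZ
  rw [det_blkC_mul_add]
  exact lform_ne_zero (isIsotropic_minors M) (minors_ne_zero M) hx

/-- Casting integral matrices to complex ones. -/
def castMat : Matrix (Fin 2) (Fin 2) ℤ →+* Mat2 := (Int.castRingHom ℂ).mapMatrix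

lemma blk_relations (M : Gam) : (blkA M)ᵀ * blkC M = (blkC M)ᵀ * blkA M ∧
    (blkB M)ᵀ * blkD M = (blkD M)ᵀ * blkB M ∧ (blkA M)ᵀ * blkD M - (blkC M)ᵀ * blkB M = 1 ∧
    (blkD M)ᵀ * blkA M - (blkB M)ᵀ * blkC M = 1 := by
  have h := SymplecticGroup.mem_iff'.1 M.2
  rw [← fromBlocks_toBlocks M.1] at h
  simp only [Matrix.J, fromBlocks_multiply, fromBlocks_transpose, fromBlocks_inj] at h
  simp only [Matrix.mul_zero, Matrix.mul_one, Matrix.mul_neg, zero_add, add_zero,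
    Matrix.neg_mul] at h
  obtain ⟨h1, h2, h3, h4⟩ := h
  have e1 : (M.1.toBlocks₁₁)ᵀ * M.1.toBlocks₂₁ = (M.1.toBlocks₂₁)ᵀ * M.1.toBlocks₁₁ := by
    rw [← sub_eq_zero]; rw [← neg_eq_zero]; rw [← h1]; abel
  have e2 : (M.1.toBlocks₁₂)ᵀ * M.1.toBlocks₂₂ = (M.1.toBlocks₂₂)ᵀ * M.1.toBlocks₁₂ := by
    rw [← sub_eq_zero]; rw [← neg_eq_zero]; rw [← h4]; abel
  have e3 : (M.1.toBlocks₁₁)ᵀ * M.1.toBlocks₂₂ - (M.1.toBlocks₂₁)ᵀ * M.1.toBlocks₁₂ = 1 := by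
    rw [← neg_inj]; rw [← h2]; abel
  have e4 : (M.1.toBlocks₂₂)ᵀ * M.1.toBlocks₁₁ - (M.1.toBlocks₁₂)ᵀ * M.1.toBlocks₂₁ = 1 := by
    rw [← h3]; abel
  refine ⟨?_, ?_, ?_, ?_⟩
  · have := congrArg castMat e1
    simp only [map_mul] at this
    exact this
  · have := congrArg castMat e2
    simp only [map_mul] at this
    exact this
  · have := congrArg castMat e3
    simp only [map_mul, map_sub, map_one] at this
    exact this
  · have := congrArg castMat e4
    simp only [map_mul, map_sub, map_one] at this
    exact this

/-! ### The action on the half space and the terms of the series -/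

/-- The symplectic identity `(C P + D)ᵀ (A Z + B) - (A P + B)ᵀ (C Z + D) = Z - P`. -/
lemma denom_transpose_mul_num (M : Gam) {P Z : Mat2} (hP : Pᵀ = P) :
    (blkC M * P + blkD M)ᵀ * (blkA M * Z + blkB M) -
      (blkA M * P + blkB M)ᵀ * (blkC M * Z + blkD M) = Z - P := by
  obtain ⟨h1, h2, h3, h4⟩ := blk_relations M
  simp only [transpose_add, transpose_mul, hP]
  generalize hA : (blkA M)ᵀ = At at *
  generalize hB : (blkB M)ᵀ = Bt at *
  generalize hC : (blkC M)ᵀ = Ct at *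
  generalize hD : (blkD M)ᵀ = Dt at *
  have : (P * Ct + Dt) * (blkA M * Z + blkB M) - (P * At + Bt) * (blkC M * Z + blkD M) =
      P * (Ct * blkA M - At * blkC M) * Z - P * (At * blkD M - Ct * blkB M) +
        (Dt * blkA M - Bt * blkC M) * Z + (Dt * blkB M - Bt * blkD M) := by
    noncomm_ring
  rw [this, h1, h2, h3, h4]
  simp
  abel

lemma map_conj_blk_mul_add (X Y : Matrix (Fin 2) (Fin 2) ℤ) (Z : Mat2) :
    (X.map (Int.cast : ℤ → ℂ) * Z + Y.map (Int.cast : ℤ → ℂ)).map conj =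
      X.map (Int.cast : ℤ → ℂ) * Z.map conj + Y.map (Int.cast : ℤ → ℂ) := by
  ext i j
  simp [Matrix.mul_apply, Fin.sum_univ_two]

lemma det_subConj (Z : Mat2) : (subConj Z).det = -4 * ((imPart Z).det : ℂ) := by
  have h : ∀ z : ℂ, z - conj z = 2 * Complex.I * z.im := by
    intro z
    rw [Complex.sub_conj]; push_cast; ring
  simp only [subConj, det_fin_two, Matrix.sub_apply, Matrix.map_apply, h, imPart]
  push_cast
  linear_combination (4 * ((Z 0 0).im * (Z 1 1).im - (Z 0 1).im * (Z 1 0).im : ℂ)) *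
    Complex.I_sq

lemma det_imPart_moebius (M : Gam) {Z : Mat2} (hZ : Z ∈ siegelHalfSpace) :
    (imPart (moebius M Z)).det =
      (imPart Z).det / ‖(blkC M * Z + blkD M).det‖ ^ 2 := by
  have hs : Zᵀ = Z := hZ.1
  have hw := det_denom_ne_zero M hZ
  set Q := blkC M * Z + blkD M with hQ
  set N := blkA M * Z + blkB M with hN
  have hQu : IsUnit Q.det := isUnit_iff_ne_zero.2 hw
  have hcs : (Z.map conj)ᵀ = Z.map conj := by
    rw [← transpose_map, hs]
  have hQc : Q.map conj = blkC M * Z.map conj + blkD M := map_conj_blk_mul_add _ _ _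
  have hNc : N.map conj = blkA M * Z.map conj + blkB M := map_conj_blk_mul_add _ _ _
  have hc := denom_transpose_mul_num M (P := Z.map conj) (Z := Z) hcs
  rw [← hQc, ← hNc, ← hQ, ← hN] at hc
  have hcsymm : (Q.map conj)ᵀ * N.map conj = (N.map conj)ᵀ * Q.map conj := by
    have := denom_transpose_mul_num M (P := Z.map conj) (Z := Z.map conj) hcs
    rwa [sub_self, sub_eq_zero, ← hQc, ← hNc] at this
  have hWQ : moebius M Z * Q = N := by
    rw [moebius, ← hQ, ← hN, Matrix.mul_assoc, Matrix.nonsing_inv_mul _ hQu, Matrix.mul_one]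
  have hWQc : (moebius M Z).map conj * Q.map conj = N.map conj := by
    rw [← hWQ]; exact (Matrix.map_mul (f := starRingEnd ℂ)).symm
  have hdetc : (Q.map conj).det = conj Q.det := ((starRingEnd ℂ).map_det Q).symm
  have hQcu : IsUnit (Q.map conj).det := by
    rw [hdetc]; exact isUnit_iff_ne_zero.2 (by simpa using hw)
  -- The transformation law of Z - conj Z, obtained from the symplectic identity at P = conj Z;
  -- taking determinants gives the claim.
  have hkey : (Q.map conj)ᵀ * subConj (moebius M Z) * Q = subConj Z := by
    have e : (Q.map conj)ᵀ * (moebius M Z).map conj = (N.map conj)ᵀ := by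
      have : (Q.map conj)ᵀ * (moebius M Z).map conj * Q.map conj =
          (N.map conj)ᵀ * Q.map conj := by
        rw [Matrix.mul_assoc, hWQc, hcsymm]
      calc _ = (Q.map conj)ᵀ * (moebius M Z).map conj * (Q.map conj * (Q.map conj)⁻¹) := by
            rw [Matrix.mul_nonsing_inv _ hQcu, Matrix.mul_one]
        _ = (N.map conj)ᵀ * (Q.map conj * (Q.map conj)⁻¹) := by
            rw [← Matrix.mul_assoc, this, Matrix.mul_assoc]
        _ = _ := by rw [Matrix.mul_nonsing_inv _ hQcu, Matrix.mul_one]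
    rw [subConj, Matrix.mul_sub, Matrix.sub_mul, e, Matrix.mul_assoc, hWQ, hc, subConj]
  have hdet := congrArg det hkey
  rw [det_mul, det_mul, det_transpose, hdetc, det_subConj, det_subConj] at hdet
  have hn : conj Q.det * Q.det = ((‖Q.det‖ ^ 2 : ℝ) : ℂ) := by
    rw [mul_comm, Complex.mul_conj, Complex.normSq_eq_norm_sq]
  have hfin : ((‖Q.det‖ ^ 2 * (imPart (moebius M Z)).det : ℝ) : ℂ) =
      (((imPart Z).det : ℝ) : ℂ) := by
    push_cast at hn ⊢
    rw [← hn]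
    linear_combination (-1 / 4 : ℂ) * hdet
  have hpos : ‖Q.det‖ ^ 2 ≠ 0 := by simpa using hw
  rw [eq_div_iff hpos, mul_comm]
  exact_mod_cast hfin

/-- `‖w‖ ^ (-1 - 2 s) * (conj w) ^ (1 - k)`. -/
def weightFun (k : ℤ) (s : ℝ) (w : ℂ) : ℂ := ((‖w‖ ^ (-1 - 2 * s) : ℝ) : ℂ) * conj w ^ (1 - k)

lemma norm_weightFun (k : ℤ) (s : ℝ) {w : ℂ} (hw : w ≠ 0) :
    ‖weightFun k s w‖ = ‖w‖ ^ (-(k + 2 * s)) := by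
  have : 0 < ‖w‖ := norm_pos_iff.2 hw
  rw [weightFun, norm_mul, Complex.norm_real, norm_zpow, RCLike.norm_conj, Real.norm_eq_abs,
    abs_of_nonneg (by positivity), ← Real.rpow_intCast, ← Real.rpow_add this]
  push_cast
  ring_nf

lemma half_sub_eq (k : ℤ) : (1 / 2 : ℂ) - ((k : ℂ) - 1 / 2) = ((1 - k : ℤ) : ℂ) := by
  push_cast; ring

/-- The factor ‖w‖^(-2s) comes from det Im(M ∘ Z) = det Y / ‖w‖², the remaining ones from the
automorphy factor. -/
lemma poincareTerm_eq (k : ℤ) (s : ℝ) (M : Gam) {x : ℂ × ℂ × ℂ} (hx : x ∈ halfSpaceCoords) :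
    poincareTerm k s M (ofCoords x) =
      ((imDet x ^ s : ℝ) : ℂ) * weightFun k s (lform (minors M) x) := by
  have hZ := (ofCoords_mem_siegelHalfSpace x).2 hx
  have hw := det_denom_ne_zero M hZ
  have hpos : 0 < imDet x := hx.2
  rw [poincareTerm, slash, autFactor_eq _ _ _ hw _ (half_sub_eq k), det_imPart_moebius M hZ,
    det_blkC_mul_add, det_imPart_ofCoords] at *
  set w := lform (minors M) x
  have hw' : 0 < ‖w‖ := norm_pos_iff.2 hw
  rw [weightFun, ← Complex.ofReal_cpow (by positivity), Real.div_rpow hpos.le (by positivity),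
    ← Real.rpow_natCast, ← Real.rpow_mul hw'.le]
  have e1 : (‖w‖ : ℂ) ^ (-2 * (1 / 2) : ℂ) = ((‖w‖ ^ (-1 : ℝ) : ℝ) : ℂ) := by
    rw [Complex.ofReal_cpow hw'.le]; congr 1; push_cast; ring
  have e2 : ‖w‖ ^ (-1 - 2 * s) = ‖w‖ ^ (-1 : ℝ) / ‖w‖ ^ (((2 : ℕ) : ℝ) * s) := by
    rw [Real.rpow_sub hw']; push_cast; rfl
  rw [e1, e2]
  push_cast
  ring

/-! ### Invariance -/

lemma blk_mul (M N : Gam) : blkA (M * N) = blkA M * blkA N + blkB M * blkC N ∧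
    blkB (M * N) = blkA M * blkB N + blkB M * blkD N ∧
    blkC (M * N) = blkC M * blkA N + blkD M * blkC N ∧
    blkD (M * N) = blkC M * blkB N + blkD M * blkD N := by
  have h : (M * N : Gam).1 =
      fromBlocks M.1.toBlocks₁₁ M.1.toBlocks₁₂ M.1.toBlocks₂₁ M.1.toBlocks₂₂ *
        fromBlocks N.1.toBlocks₁₁ N.1.toBlocks₁₂ N.1.toBlocks₂₁ N.1.toBlocks₂₂ := by
    rw [Submonoid.coe_mul, fromBlocks_toBlocks M.1, fromBlocks_toBlocks N.1]
  rw [fromBlocks_multiply] at h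
  have hc : ∀ X Y X' Y' : Matrix (Fin 2) (Fin 2) ℤ, castMat (X * Y + X' * Y') =
      castMat X * castMat Y + castMat X' * castMat Y' := fun X Y X' Y' => by
    simp only [map_mul, map_add]
  refine ⟨?_, ?_, ?_, ?_⟩
  · rw [blkA, h, toBlocks_fromBlocks₁₁]; exact hc _ _ _ _
  · rw [blkB, h, toBlocks_fromBlocks₁₂]; exact hc _ _ _ _
  · rw [blkC, h, toBlocks_fromBlocks₂₁]; exact hc _ _ _ _
  · rw [blkD, h, toBlocks_fromBlocks₂₂]; exact hc _ _ _ _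

lemma denom_cocycle (M N : Gam) {Z : Mat2} (hZ : IsUnit (blkC N * Z + blkD N).det) :
    blkC (M * N) * Z + blkD (M * N) =
      (blkC M * moebius N Z + blkD M) * (blkC N * Z + blkD N) := by
  obtain ⟨-, -, h3, h4⟩ := blk_mul M N
  rw [h3, h4, Matrix.add_mul (blkC M * moebius N Z), Matrix.mul_assoc (blkC M), moebius,
    Matrix.mul_assoc _ (_)⁻¹, Matrix.nonsing_inv_mul _ hZ]
  noncomm_ring

lemma moebius_mul (M N : Gam) {Z : Mat2} (hZ : IsUnit (blkC N * Z + blkD N).det) :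
    moebius (M * N) Z = moebius M (moebius N Z) := by
  have h : blkA (M * N) * Z + blkB (M * N) =
      (blkA M * moebius N Z + blkB M) * (blkC N * Z + blkD N) := by
    obtain ⟨h1, h2, -, -⟩ := blk_mul M N
    rw [h1, h2, Matrix.add_mul (blkA M * moebius N Z), Matrix.mul_assoc (blkA M), moebius,
      Matrix.mul_assoc _ (_)⁻¹, Matrix.nonsing_inv_mul _ hZ]
    noncomm_ring
  rw [moebius, h, denom_cocycle M N hZ, Matrix.mul_inv_rev, ← Matrix.mul_assoc,
    Matrix.mul_assoc _ (blkC N * Z + blkD N), Matrix.mul_nonsing_inv _ hZ, Matrix.mul_one]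
  rfl

/-- The cocycle relation of CZ + D. The automorphy factor is multiplicative in its form with an
integral power of conj w; principal branches alone would not give this. -/
lemma slash_poincareTerm (k : ℤ) (s : ℂ) (M N : Gam) {Z : Mat2} (hZ : Z ∈ siegelHalfSpace) :
    slash (1 / 2) ((k : ℂ) - 1 / 2) (poincareTerm k s M) N Z = poincareTerm k s (M * N) Z := by
  have hN := det_denom_ne_zero N hZ
  have hMN := det_denom_ne_zero (M * N) hZ
  have hu := isUnit_iff_ne_zero.2 hN
  rw [denom_cocycle M N hu, det_mul] at hMN
  rw [slash, poincareTerm, poincareTerm, slash, slash, denom_cocycle M N hu, moebius_mul M N hu,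
    det_mul, autFactor_eq _ _ _ hN _ (half_sub_eq k), autFactor_eq _ _ _ hMN _ (half_sub_eq k),
    autFactor_eq _ _ _ (left_ne_zero_of_mul hMN) _ (half_sub_eq k), norm_mul, map_mul, mul_zpow,
    Complex.ofReal_mul, Complex.mul_cpow_ofReal_nonneg (norm_nonneg _) (norm_nonneg _)]
  ring

/-- Right multiplication by `N` on the cosets `Γ_∞ M`. -/
def mulRightCosets (N : Gam) : Cosets ≃ Cosets :=
  Quotient.congr (Equiv.mulRight N) fun M M' => by
    simp only [QuotientGroup.rightRel_apply, Equiv.coe_mulRight, _root_.mul_inv_rev]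
    rw [mul_assoc M' N, mul_inv_cancel_left]

lemma poincareTerm_out_mul (k : ℤ) (hk : Odd k) (s : ℂ) (q : Cosets) (N : Gam) (Z : Mat2) :
    poincareTerm k s (q.out * N) Z = poincareTerm k s (mulRightCosets N q).out Z := by
  refine poincareTerm_rightRel k hk s _ _ (Quotient.exact ?_) Z
  rw [Quotient.out_eq]
  conv_rhs => rw [← Quotient.out_eq q]
  rfl

/-- The Poincaré–Eisenstein series is invariant under the slash action. -/
lemma slash_poincareSeries (k : ℤ) (hk : Odd k) (s : ℂ) (N : Gam) {Z : Mat2}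
    (hZ : Z ∈ siegelHalfSpace) :
    slash (1 / 2) ((k : ℂ) - 1 / 2) (poincareSeries k s) N Z = poincareSeries k s Z := by
  have h : slash (1 / 2) ((k : ℂ) - 1 / 2) (poincareSeries k s) N Z =
      ∑' q : Cosets, slash (1 / 2) ((k : ℂ) - 1 / 2) (poincareTerm k s q.out) N Z := by
    simp only [slash, poincareSeries, tsum_mul_left]
  rw [h, poincareSeries,
    ← (mulRightCosets N).tsum_eq fun q => poincareTerm k s q.out Z]
  exact tsum_congr fun q => by rw [slash_poincareTerm k s _ _ hZ, poincareTerm_out_mul k hk]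

/-- The translation `Z ↦ Z + S` for an integral symmetric matrix `S`. -/
def translation (S : ℤ × ℤ × ℤ) : Gam :=
  ⟨fromBlocks 1 !![S.1, S.2.1; S.2.1, S.2.2] 0 1, by
    have hS : (!![S.1, S.2.1; S.2.1, S.2.2] : Matrix (Fin 2) (Fin 2) ℤ)ᵀ =
        !![S.1, S.2.1; S.2.1, S.2.2] := by
      ext i j; fin_cases i <;> fin_cases j <;> simp
    rw [SymplecticGroup.mem_iff]
    generalize (!![S.1, S.2.1; S.2.1, S.2.2] : Matrix (Fin 2) (Fin 2) ℤ) = T at hS ⊢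
    simp [Matrix.J, fromBlocks_multiply, fromBlocks_transpose, hS]⟩

/-- The Poincaré–Eisenstein series is periodic. -/
lemma poincareSeries_add (k : ℤ) (hk : Odd k) (s : ℂ) (S : ℤ × ℤ × ℤ) {x : ℂ × ℂ × ℂ}
    (hx : x ∈ halfSpaceCoords) :
    poincareSeries k s (ofCoords (x.1 + S.1, x.2.1 + S.2.1, x.2.2 + S.2.2)) =
      poincareSeries k s (ofCoords x) := by
  rw [← slash_poincareSeries k hk s (translation S) ((ofCoords_mem_siegelHalfSpace x).2 hx), slash]
  have hC : blkC (translation S) = 0 := by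
    rw [blkC, translation, toBlocks_fromBlocks₂₁]; simp
  have hD : blkD (translation S) = 1 := by
    rw [blkD, translation, toBlocks_fromBlocks₂₂]; simp
  have hA : blkA (translation S) = 1 := by
    rw [blkA, translation, toBlocks_fromBlocks₁₁]; simp
  have hm : moebius (translation S) (ofCoords x) =
      ofCoords (x.1 + S.1, x.2.1 + S.2.1, x.2.2 + S.2.2) := by
    rw [moebius, hA, hC, hD]
    ext i j
    fin_cases i <;> fin_cases j <;>
      simp [blkB, translation, toBlocks_fromBlocks₁₂, ofCoords]
  rw [hm, hC, hD]
  simp [autFactor]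

/-! ### The differential operators in coordinates -/

/-- The coordinate direction belonging to the `(i, j)` entry. -/
def crdDir (i j : Fin 2) : ℂ × ℂ × ℂ :=
  if i = j then (if i = 0 then (1, 0, 0) else (0, 0, 1)) else (0, 1, 0)

lemma ofCoords_crdDir (i j : Fin 2) : ofCoords (crdDir i j) = symDir i j := by
  ext a b
  fin_cases i <;> fin_cases j <;> fin_cases a <;> fin_cases b <;>
    simp [ofCoords, crdDir, symDir, Matrix.single]

lemma ofCoords_I_smul_crdDir (i j : Fin 2) :
    ofCoords (Complex.I • crdDir i j) = Complex.I • symDir i j := by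
  rw [← ofCoords_crdDir]
  ext a b
  fin_cases a <;> fin_cases b <;> simp [ofCoords]

lemma ofCoords_add_smul (x h : ℂ × ℂ × ℂ) (t : ℝ) :
    ofCoords (x + t • h) = ofCoords x + t • ofCoords h := by
  ext a b
  fin_cases a <;> fin_cases b <;> simp [ofCoords]

section VectorValued

variable {E : Type*} [NormedAddCommGroup E] [NormedSpace ℂ E]

/-- The Wirtinger derivative of a vector-valued function of the coordinates. -/
def wirtE (i j : Fin 2) (f : ℂ × ℂ × ℂ → E) (x : ℂ × ℂ × ℂ) : E :=
  (1 / 2 : ℂ) • (lineDeriv ℝ f x (crdDir i j)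
    - Complex.I • lineDeriv ℝ f x (Complex.I • crdDir i j))

/-- The conjugate Wirtinger derivative of a vector-valued function of the coordinates. -/
def wirtBarE (i j : Fin 2) (f : ℂ × ℂ × ℂ → E) (x : ℂ × ℂ × ℂ) : E :=
  (1 / 2 : ℂ) • (lineDeriv ℝ f x (crdDir i j)
    + Complex.I • lineDeriv ℝ f x (Complex.I • crdDir i j))

/-- The `(i, j)` entry of `K_α f`. -/
def opKE (α : ℂ) (f : ℂ × ℂ × ℂ → E) (i j : Fin 2) (x : ℂ × ℂ × ℂ) : E :=
  (α * (1 : Mat2) i j) • f x +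
    ∑ l, (subConj (ofCoords x) i l * entryWeight l j) • wirtE l j f x

/-- The `(i, j)` entry of `Ω_{α,β} f`. -/
def opOmegaE (α β : ℂ) (f : ℂ × ℂ × ℂ → E) (i j : Fin 2) (x : ℂ × ℂ × ℂ) : E :=
  (-(β - 3 / 2)) • opKE α f i j x +
    ∑ m, subConj (ofCoords x) i m • ∑ l, entryWeight m l • wirtBarE m l (opKE α f l j) x +
    (α * (β - 3 / 2) * (1 : Mat2) i j) • f x

lemma lineDeriv_ofCoords (F : Mat2 → ℂ) (x h : ℂ × ℂ × ℂ) :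
    lineDeriv ℝ F (ofCoords x) (ofCoords h) = lineDeriv ℝ (fun y => F (ofCoords y)) x h := by
  simp only [lineDeriv, ofCoords_add_smul]

lemma wirt_ofCoords (i j : Fin 2) (F : Mat2 → ℂ) (x : ℂ × ℂ × ℂ) :
    wirt i j F (ofCoords x) = wirtE i j (fun y => F (ofCoords y)) x := by
  rw [wirt, wirtE, ← lineDeriv_ofCoords, ← lineDeriv_ofCoords, ofCoords_crdDir,
    ofCoords_I_smul_crdDir, smul_eq_mul, smul_eq_mul]

lemma wirtBar_ofCoords (i j : Fin 2) (F : Mat2 → ℂ) (x : ℂ × ℂ × ℂ) :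
    wirtBar i j F (ofCoords x) = wirtBarE i j (fun y => F (ofCoords y)) x := by
  rw [wirtBar, wirtBarE, ← lineDeriv_ofCoords, ← lineDeriv_ofCoords, ofCoords_crdDir,
    ofCoords_I_smul_crdDir, smul_eq_mul, smul_eq_mul]

lemma opK_ofCoords (α : ℂ) (F : Mat2 → ℂ) (i j : Fin 2) (x : ℂ × ℂ × ℂ) :
    opK α F (ofCoords x) i j = opKE α (fun y => F (ofCoords y)) i j x := by
  simp only [opK, opKE, Matrix.add_apply, Matrix.smul_apply, Matrix.mul_apply, dZ, of_apply,
    wirt_ofCoords, smul_eq_mul]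
  congr 1
  · ring
  · exact Finset.sum_congr rfl fun l _ => by ring

lemma opOmega_ofCoords (α β : ℂ) (F : Mat2 → ℂ) (i j : Fin 2) (x : ℂ × ℂ × ℂ) :
    opOmega α β F (ofCoords x) i j = opOmegaE α β (fun y => F (ofCoords y)) i j x := by
  simp only [opOmega, opLambda, opOmegaE, Matrix.add_apply, Matrix.smul_apply, Matrix.mul_apply,
    dZbar, of_apply, wirtBar_ofCoords, smul_eq_mul, opK_ofCoords]
  ring

lemma wirtE_congr {i j : Fin 2} {f g : ℂ × ℂ × ℂ → E} {x : ℂ × ℂ × ℂ} (h : f =ᶠ[nhds x] g) :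
    wirtE i j f x = wirtE i j g x := by
  rw [wirtE, wirtE, h.lineDeriv_eq, h.lineDeriv_eq]

lemma wirtBarE_congr {i j : Fin 2} {f g : ℂ × ℂ × ℂ → E} {x : ℂ × ℂ × ℂ} (h : f =ᶠ[nhds x] g) :
    wirtBarE i j f x = wirtBarE i j g x := by
  rw [wirtBarE, wirtBarE, h.lineDeriv_eq, h.lineDeriv_eq]

lemma opKE_congr {α : ℂ} {f g : ℂ × ℂ × ℂ → E} {i j : Fin 2} {x : ℂ × ℂ × ℂ}
    (h : f =ᶠ[nhds x] g) : opKE α f i j =ᶠ[nhds x] opKE α g i j := by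
  filter_upwards [h.eventually_nhds] with y hy
  have hy : f =ᶠ[nhds y] g := hy
  simp only [opKE, wirtE_congr hy, hy.eq_of_nhds]

lemma opOmegaE_congr {α β : ℂ} {f g : ℂ × ℂ × ℂ → E} {i j : Fin 2} {x : ℂ × ℂ × ℂ}
    (h : f =ᶠ[nhds x] g) : opOmegaE α β f i j x = opOmegaE α β g i j x := by
  simp only [opOmegaE, wirtBarE_congr (opKE_congr h), (opKE_congr h).eq_of_nhds, h.eq_of_nhds]

lemma lineDeriv_clm_comp {f : ℂ × ℂ × ℂ → E} {x : ℂ × ℂ × ℂ} (hf : DifferentiableAt ℝ f x)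
    (L : E →L[ℂ] ℂ) (h : ℂ × ℂ × ℂ) :
    lineDeriv ℝ (fun y => L (f y)) x h = L (lineDeriv ℝ f x h) := by
  have hL : HasFDerivAt (fun y => L (f y)) ((L.restrictScalars ℝ).comp (fderiv ℝ f x)) x :=
    (L.restrictScalars ℝ).hasFDerivAt.comp x hf.hasFDerivAt
  rw [hf.lineDeriv_eq_fderiv, hL.differentiableAt.lineDeriv_eq_fderiv, hL.fderiv]
  rfl

lemma wirtE_clm_comp {i j : Fin 2} {f : ℂ × ℂ × ℂ → E} {x : ℂ × ℂ × ℂ}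
    (hf : DifferentiableAt ℝ f x) (L : E →L[ℂ] ℂ) :
    wirtE i j (fun y => L (f y)) x = L (wirtE i j f x) := by
  simp only [wirtE, lineDeriv_clm_comp hf, map_smul, map_sub]

lemma wirtBarE_clm_comp {i j : Fin 2} {f : ℂ × ℂ × ℂ → E} {x : ℂ × ℂ × ℂ}
    (hf : DifferentiableAt ℝ f x) (L : E →L[ℂ] ℂ) :
    wirtBarE i j (fun y => L (f y)) x = L (wirtBarE i j f x) := by
  simp only [wirtBarE, lineDeriv_clm_comp hf, map_smul, map_add]

lemma differentiable_subConj (i j : Fin 2) :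
    Differentiable ℝ fun x : ℂ × ℂ × ℂ => subConj (ofCoords x) i j := by
  have h : ∀ g : ℂ × ℂ × ℂ → ℂ, Differentiable ℝ g → Differentiable ℝ fun x => g x - conj (g x) :=
    fun g hg => hg.sub (Complex.conjCLE.differentiable.comp hg)
  fin_cases i <;> fin_cases j <;> simp only [subConj, ofCoords, Matrix.sub_apply, Matrix.map_apply]
  · exact h (fun x => x.1) (by fun_prop)
  · exact h (fun x => x.2.1) (by fun_prop)
  · exact h (fun x => x.2.1) (by fun_prop)
  · exact h (fun x => x.2.2) (by fun_prop)

variable [CompleteSpace E]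

lemma differentiableAt_wirtE {i j : Fin 2} {f : ℂ × ℂ × ℂ → E} {x : ℂ × ℂ × ℂ}
    (hf : AnalyticAt ℝ f x) : DifferentiableAt ℝ (wirtE i j f) x := by
  have h1 : wirtE i j f =ᶠ[nhds x] fun y => (1 / 2 : ℂ) • (fderiv ℝ f y (crdDir i j)
      - Complex.I • fderiv ℝ f y (Complex.I • crdDir i j)) := by
    filter_upwards [hf.eventually_analyticAt] with y hy
    rw [wirtE, hy.differentiableAt.lineDeriv_eq_fderiv, hy.differentiableAt.lineDeriv_eq_fderiv]
  refine DifferentiableAt.congr_of_eventuallyEq ?_ h1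
  have h2 := hf.fderiv.differentiableAt
  exact ((h2.clm_apply (differentiableAt_const _)).sub
    ((h2.clm_apply (differentiableAt_const _)).const_smul _)).const_smul _

lemma differentiableAt_opKE {α : ℂ} {i j : Fin 2} {f : ℂ × ℂ × ℂ → E} {x : ℂ × ℂ × ℂ}
    (hf : AnalyticAt ℝ f x) : DifferentiableAt ℝ (opKE α f i j) x := by
  refine (hf.differentiableAt.const_smul _).add (DifferentiableAt.fun_sum fun l _ => ?_)
  exact (((differentiable_subConj i l).differentiableAt).mul_const _).smul
    (differentiableAt_wirtE hf)

/-- The operator `Ω` commutes with continuous linear functionals. -/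
lemma opOmegaE_clm_comp {α β : ℂ} {i j : Fin 2} {f : ℂ × ℂ × ℂ → E} {x : ℂ × ℂ × ℂ}
    (hf : AnalyticAt ℝ f x) (L : E →L[ℂ] ℂ) :
    opOmegaE α β (fun y => L (f y)) i j x = L (opOmegaE α β f i j x) := by
  have hK : ∀ l j, opKE α (fun y => L (f y)) l j =ᶠ[nhds x] fun y => L (opKE α f l j y) := by
    intro l j
    filter_upwards [hf.eventually_analyticAt] with y hy
    simp only [opKE, wirtE_clm_comp hy.differentiableAt, map_add, map_sum, map_smul]
  simp only [opOmegaE, wirtBarE_congr (hK _ _), (hK _ _).eq_of_nhds,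
    wirtBarE_clm_comp (differentiableAt_opKE hf), map_add, map_sum, map_smul]

end VectorValued

/-! ### Wirtinger derivatives along a direction -/

/-- `f` has Wirtinger derivatives `d` and `b` at `x` along the direction `h`. -/
def HasWirt (f : ℂ × ℂ × ℂ → ℂ) (x h : ℂ × ℂ × ℂ) (d b : ℂ) : Prop :=
  HasDerivAt (fun t : ℝ => f (x + t • h)) (d + b) 0 ∧
    HasDerivAt (fun t : ℝ => f (x + t • (Complex.I • h))) (Complex.I * (d - b)) 0

namespace HasWirt

variable {f g : ℂ × ℂ × ℂ → ℂ} {x h : ℂ × ℂ × ℂ} {d b d' b' : ℂ} {i j : Fin 2}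

/-- The derivatives along h and I • h are d + b and I (d - b), from which the Wirtinger combinations
recover d and b. -/
lemma wirtE_eq (hf : HasWirt f x (crdDir i j) d b) : wirtE i j f x = d := by
  rw [wirtE, lineDeriv, lineDeriv, hf.1.deriv, hf.2.deriv, smul_eq_mul, smul_eq_mul]
  linear_combination (-(d - b) / 2) * Complex.I_sq

lemma wirtBarE_eq (hf : HasWirt f x (crdDir i j) d b) : wirtBarE i j f x = b := by
  rw [wirtBarE, lineDeriv, lineDeriv, hf.1.deriv, hf.2.deriv, smul_eq_mul, smul_eq_mul]
  linear_combination ((d - b) / 2) * Complex.I_sq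

lemma congr_val (hf : HasWirt f x h d b) (hd : d = d') (hb : b = b') : HasWirt f x h d' b' := by
  subst hd hb; exact hf

lemma const (c : ℂ) : HasWirt (fun _ => c) x h 0 0 := by
  constructor <;> simpa using hasDerivAt_const (0 : ℝ) c

lemma add (hf : HasWirt f x h d b) (hg : HasWirt g x h d' b') :
    HasWirt (fun y => f y + g y) x h (d + d') (b + b') :=
  ⟨(hf.1.add hg.1).congr_deriv (by ring), (hf.2.add hg.2).congr_deriv (by ring)⟩

lemma sub (hf : HasWirt f x h d b) (hg : HasWirt g x h d' b') :
    HasWirt (fun y => f y - g y) x h (d - d') (b - b') :=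
  ⟨(hf.1.sub hg.1).congr_deriv (by ring), (hf.2.sub hg.2).congr_deriv (by ring)⟩

lemma mul (hf : HasWirt f x h d b) (hg : HasWirt g x h d' b') :
    HasWirt (fun y => f y * g y) x h (d * g x + f x * d') (b * g x + f x * b') := by
  have h1 := hf.1.mul hg.1
  have h2 := hf.2.mul hg.2
  simp only [zero_smul, add_zero] at h1 h2
  exact ⟨h1.congr_deriv (by ring), h2.congr_deriv (by ring)⟩

lemma const_mul (c : ℂ) (hf : HasWirt f x h d b) : HasWirt (fun y => c * f y) x h (c * d) (c * b) :=
  ((const c).mul hf).congr_val (by ring) (by ring)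

lemma conj_comp (hf : HasWirt f x h d b) :
    HasWirt (fun y => starRingEnd ℂ (f y)) x h (starRingEnd ℂ b) (starRingEnd ℂ d) := by
  have e : ∀ {u : ℝ → ℂ} {u' : ℂ}, HasDerivAt u u' 0 →
      HasDerivAt (fun t => starRingEnd ℂ (u t)) (starRingEnd ℂ u') 0 := fun hu =>
    (Complex.conjCLE.toContinuousLinearMap.hasFDerivAt.comp_hasDerivAt (0 : ℝ) hu)
  refine ⟨(e hf.1).congr_deriv ?_, (e hf.2).congr_deriv ?_⟩
  · rw [map_add, add_comm]
  · rw [map_mul, map_sub, Complex.conj_I]; ring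

lemma cpow_const (c : ℂ) (hf : HasWirt f x h d b) (hx : f x ∈ Complex.slitPlane) :
    HasWirt (fun y => f y ^ c) x h (c * f x ^ (c - 1) * d) (c * f x ^ (c - 1) * b) := by
  have e : ∀ {u : ℝ → ℂ} {u' : ℂ}, HasDerivAt u u' 0 → u 0 = f x →
      HasDerivAt (fun t => u t ^ c) (c * f x ^ (c - 1) * u') 0 := by
    intro u u' hu h0
    have h1 : HasDerivAt (fun z : ℂ => z ^ c) (c * u 0 ^ (c - 1) * 1) (u 0) :=
      (hasDerivAt_id _).cpow_const (by simpa [h0] using hx)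
    have := HasDerivAt.comp (0 : ℝ) h1 hu
    rw [h0, mul_one] at this
    exact this
  exact ⟨(e hf.1 (by simp)).congr_deriv (by ring), (e hf.2 (by simp)).congr_deriv (by ring)⟩

lemma inv (hf : HasWirt f x h d b) (hx : f x ≠ 0) :
    HasWirt (fun y => (f y)⁻¹) x h (-d / f x ^ 2) (-b / f x ^ 2) := by
  have h1 := hf.1.inv (by simpa using hx)
  have h2 := hf.2.inv (by simpa using hx)
  simp only [zero_smul, add_zero] at h1 h2
  exact ⟨h1.congr_deriv (by ring), h2.congr_deriv (by ring)⟩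

lemma fst : HasWirt (fun y => y.1) x h h.1 0 := by
  constructor
  · simpa using ((hasDerivAt_id (0 : ℝ)).ofReal_comp.mul_const h.1).const_add x.1
  · simpa using ((hasDerivAt_id (0 : ℝ)).ofReal_comp.mul_const (Complex.I * h.1)).const_add x.1

lemma snd_fst : HasWirt (fun y => y.2.1) x h h.2.1 0 := by
  constructor
  · simpa using ((hasDerivAt_id (0 : ℝ)).ofReal_comp.mul_const h.2.1).const_add x.2.1
  · simpa using ((hasDerivAt_id (0 : ℝ)).ofReal_comp.mul_const (Complex.I * h.2.1)).const_add x.2.1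

lemma snd_snd : HasWirt (fun y => y.2.2) x h h.2.2 0 := by
  constructor
  · simpa using ((hasDerivAt_id (0 : ℝ)).ofReal_comp.mul_const h.2.2).const_add x.2.2
  · simpa using ((hasDerivAt_id (0 : ℝ)).ofReal_comp.mul_const (Complex.I * h.2.2)).const_add x.2.2

end HasWirt

/-! ### Harmonicity of a single term -/

/-- The matrix `∂_Z` of the linear form. -/
def lgrad (v : Vec5) (x : ℂ × ℂ × ℂ) : Mat2 :=
  !![v.2.1 * x.2.2 + v.1.2.2, v.1.2.1 - v.2.1 * x.2.1;
    v.1.2.1 - v.2.1 * x.2.1, v.2.1 * x.1 + v.1.1]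

lemma hasWirt_lform (v : Vec5) (x : ℂ × ℂ × ℂ) (i j : Fin 2) :
    HasWirt (lform v) x (crdDir i j) ((entryWeight i j)⁻¹ * lgrad v x i j) 0 := by
  have h := ((((((HasWirt.fst (x := x) (h := crdDir i j)).mul HasWirt.snd_snd).sub
    (HasWirt.snd_fst.mul HasWirt.snd_fst)).const_mul v.2.1).add
    (HasWirt.fst.const_mul v.1.2.2)).add (HasWirt.snd_snd.const_mul v.1.1)).add
    (HasWirt.snd_fst.const_mul (2 * v.1.2.1)) |>.add (HasWirt.const (v.2.2 : ℂ))
  have e : lform v = fun x : ℂ × ℂ × ℂ => v.2.1 * (x.1 * x.2.2 - x.2.1 * x.2.1) + v.1.2.2 * x.1 +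
      v.1.1 * x.2.2 + 2 * v.1.2.1 * x.2.1 + v.2.2 := by
    ext x; simp only [lform]; ring
  rw [e]
  refine h.congr_val ?_ (by simp)
  fin_cases i <;> fin_cases j <;> simp [crdDir, entryWeight, lgrad] <;> ring

lemma hasWirt_subConj (l m i j : Fin 2) (x : ℂ × ℂ × ℂ) :
    HasWirt (fun y => subConj (ofCoords y) l m) x (crdDir i j) (symDir i j l m)
      (-symDir i j l m) := by
  have h : ∀ {g : ℂ × ℂ × ℂ → ℂ} {d : ℂ}, HasWirt g x (crdDir i j) d 0 →
      HasWirt (fun y => g y - conj (g y)) x (crdDir i j) d (-conj d) := fun hg =>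
    (hg.sub hg.conj_comp).congr_val (by simp) (by simp)
  fin_cases l <;> fin_cases m <;> simp only [subConj, ofCoords, Matrix.sub_apply, Matrix.map_apply]
  · refine (h HasWirt.fst).congr_val ?_ ?_ <;>
      fin_cases i <;> fin_cases j <;> simp [crdDir, symDir, Matrix.single]
  · refine (h HasWirt.snd_fst).congr_val ?_ ?_ <;>
      fin_cases i <;> fin_cases j <;> simp [crdDir, symDir, Matrix.single]
  · refine (h HasWirt.snd_fst).congr_val ?_ ?_ <;>
      fin_cases i <;> fin_cases j <;> simp [crdDir, symDir, Matrix.single]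
  · refine (h HasWirt.snd_snd).congr_val ?_ ?_ <;>
      fin_cases i <;> fin_cases j <;> simp [crdDir, symDir, Matrix.single]

/-- `det Y`, expressed through `Z - conj Z`. -/
def cdet (x : ℂ × ℂ × ℂ) : ℂ := (-1 / 4) * (subConj (ofCoords x)).det

lemma cdet_eq (x : ℂ × ℂ × ℂ) : cdet x = (imDet x : ℂ) := by
  rw [cdet, det_subConj, det_imPart_ofCoords]; ring

/-- The derivative of a determinant is given by the adjugate. The conjugate derivative has the
opposite sign because only Z - conj Z enters. -/
lemma hasWirt_cdet (x : ℂ × ℂ × ℂ) (i j : Fin 2) :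
    HasWirt cdet x (crdDir i j)
      ((entryWeight i j)⁻¹ * ((-1 / 4) * (subConj (ofCoords x)).adjugate i j))
      (-((entryWeight i j)⁻¹ * ((-1 / 4) * (subConj (ofCoords x)).adjugate i j))) := by
  have h := (((hasWirt_subConj 0 0 i j x).mul (hasWirt_subConj 1 1 i j x)).sub
    ((hasWirt_subConj 0 1 i j x).mul (hasWirt_subConj 1 0 i j x))).const_mul (-1 / 4)
  have e : cdet = fun x => (-1 / 4) * (subConj (ofCoords x) 0 0 * subConj (ofCoords x) 1 1 -
      subConj (ofCoords x) 0 1 * subConj (ofCoords x) 1 0) := by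
    ext x; rw [cdet, det_fin_two]
  have hs : subConj (ofCoords x) 1 0 = subConj (ofCoords x) 0 1 := by
    simp [subConj, ofCoords]
  rw [e]
  refine h.congr_val ?_ ?_ <;> rw [hs] <;> fin_cases i <;> fin_cases j <;>
    simp [symDir, entryWeight, adjugate_fin_two, Matrix.single, hs] <;> ring

/-- `(det Y) ^ s * (w / w₀) ^ A * conj ((w / w₀) ^ B)`. -/
def localTerm (s A B : ℝ) (v : Vec5) (w₀ : ℂ) (x : ℂ × ℂ × ℂ) : ℂ :=
  cdet x ^ (s : ℂ) * ((w₀⁻¹ * lform v x) ^ (A : ℂ) * conj ((w₀⁻¹ * lform v x) ^ (B : ℂ)))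

lemma hasWirt_localTerm (s A B : ℝ) (v : Vec5) {w₀ : ℂ} (hw₀ : w₀ ≠ 0) {x : ℂ × ℂ × ℂ}
    (hx : 0 < imDet x) (hsl : w₀⁻¹ * lform v x ∈ Complex.slitPlane) (i j : Fin 2) :
    HasWirt (localTerm s A B v w₀) x (crdDir i j)
      (localTerm s A B v w₀ x * ((entryWeight i j)⁻¹ *
        (A * (lgrad v x i j / lform v x) -
          s * ((subConj (ofCoords x)).adjugate i j / (4 * cdet x)))))
      (localTerm s A B v w₀ x * ((entryWeight i j)⁻¹ *
        (B * conj (lgrad v x i j / lform v x) +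
          s * ((subConj (ofCoords x)).adjugate i j / (4 * cdet x))))) := by
  have hc0 : cdet x ≠ 0 := by rw [cdet_eq]; exact_mod_cast hx.ne'
  have hcs : cdet x ∈ Complex.slitPlane := by
    rw [cdet_eq]; exact Complex.ofReal_mem_slitPlane.2 hx
  have hg0 : w₀⁻¹ * lform v x ≠ 0 := Complex.slitPlane_ne_zero hsl
  have hl0 : lform v x ≠ 0 := right_ne_zero_of_mul hg0
  have hg := (hasWirt_lform v x i j).const_mul w₀⁻¹
  have h := ((hasWirt_cdet x i j).cpow_const s hcs).mul
    ((hg.cpow_const A hsl).mul ((hg.cpow_const B hsl).conj_comp))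
  have he : conj (entryWeight i j) = entryWeight i j := by
    unfold entryWeight; split_ifs <;> simp [map_ofNat]
  have e1 : cdet x ^ ((s : ℂ) - 1) = cdet x ^ (s : ℂ) / cdet x := by
    rw [Complex.cpow_sub _ _ hc0, Complex.cpow_one]
  have e2 : ∀ C : ℂ, (w₀⁻¹ * lform v x) ^ (C - 1) =
      (w₀⁻¹ * lform v x) ^ C / (w₀⁻¹ * lform v x) := fun C => by
    rw [Complex.cpow_sub _ _ hg0, Complex.cpow_one]
  have hl0c : conj (lform v x) ≠ 0 := by simpa using hl0
  have hw0c : conj w₀ ≠ 0 := by simpa using hw₀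
  refine h.congr_val ?_ ?_
  · simp only [e1, e2, localTerm, mul_zero, map_zero, add_zero]
    field_simp
    ring
  · simp only [e1, e2, localTerm, mul_zero, map_mul, map_div₀, map_inv₀, Complex.conj_ofReal,
      he, zero_mul, zero_add]
    field_simp
    ring

lemma subConj_mul_adjugate (x : ℂ × ℂ × ℂ) :
    subConj (ofCoords x) * (subConj (ofCoords x)).adjugate = (-4 * cdet x) • (1 : Mat2) := by
  rw [mul_adjugate, cdet]; congr 1; ring

/-- `1 - (Z - conj Z) ∂_Z w / w`. -/
def quotMat (v : Vec5) (x : ℂ × ℂ × ℂ) : Mat2 :=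
  1 - (lform v x)⁻¹ • (subConj (ofCoords x) * lgrad v x)

lemma entryWeight_ne_zero (i j : Fin 2) : entryWeight i j ≠ 0 := by
  unfold entryWeight; split_ifs <;> norm_num

/-- Logarithmic differentiation gives the factor 1/2 + A U V + s, where U = Z - conj Z, V = w⁻¹ ∂_Z
w, and the last term comes from U adj U = -4 det Y. The choice of A makes it proportional to 1 - U
V. -/
lemma opKE_localTerm (s A B : ℝ) (v : Vec5) {w₀ : ℂ} (hw₀ : w₀ ≠ 0) {x : ℂ × ℂ × ℂ}
    (hx : 0 < imDet x) (hsl : w₀⁻¹ * lform v x ∈ Complex.slitPlane) (hA : A = -(1 / 2 + s))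
    (i j : Fin 2) :
    opKE (1 / 2) (localTerm s A B v w₀) i j x =
      (1 / 2 + s) * (localTerm s A B v w₀ x * quotMat v x i j) := by
  have hc0 : cdet x ≠ 0 := by rw [cdet_eq]; exact_mod_cast hx.ne'
  have h := congrFun (congrFun (subConj_mul_adjugate x) i) j
  have e : ∀ l, (subConj (ofCoords x) i l * entryWeight l j) •
      wirtE l j (localTerm s A B v w₀) x = localTerm s A B v w₀ x *
        (A * (lform v x)⁻¹ * (subConj (ofCoords x) i l * lgrad v x l j) - s / (4 * cdet x) *
        (subConj (ofCoords x) i l * (subConj (ofCoords x)).adjugate l j)) := by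
    intro l
    rw [(hasWirt_localTerm s A B v hw₀ hx hsl l j).wirtE_eq, smul_eq_mul]
    have := entryWeight_ne_zero l j
    field_simp
  rw [opKE, Finset.sum_congr rfl fun l _ => e l, ← Finset.mul_sum, Finset.sum_sub_distrib,
    ← Finset.mul_sum, ← Finset.mul_sum, ← Matrix.mul_apply, ← Matrix.mul_apply, h, hA]
  simp only [quotMat, Matrix.sub_apply, Matrix.smul_apply, smul_eq_mul]
  push_cast
  field_simp
  ring

/-- The isotropy of `v` in terms of the linear form and its gradient. -/
lemma conj_lgrad_mul_quotMat {v : Vec5} (hv : IsIsotropic v) {x : ℂ × ℂ × ℂ}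
    (hw : lform v x ≠ 0) :
    ((conj (lform v x))⁻¹ • (lgrad v x).map conj) * quotMat v x = (lform v x)⁻¹ • lgrad v x := by
  have hwc : conj (lform v x) ≠ 0 := by simpa using hw
  have hvc : (v.2.1 : ℂ) * v.2.2 = v.1.1 * v.1.2.2 - (v.1.2.1 : ℂ) ^ 2 := by exact_mod_cast hv
  have h2 : (starRingEnd ℂ) 2 = 2 := map_ofNat _ 2
  -- If V = (CZ + D)⁻¹ C with C invertible, this is the resolvent identity conj V - V = conj V (Z -
  -- conj Z) V. For a general isotropic vector each entry is a multiple of the quadric equation.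
  have key : (lgrad v x).map conj * (lform v x • (1 : Mat2) - subConj (ofCoords x) * lgrad v x) =
      conj (lform v x) • lgrad v x := by
    ext i j
    fin_cases i <;> fin_cases j <;>
      simp [lgrad, subConj, ofCoords, Matrix.mul_apply, Fin.sum_univ_two, lform, h2]
    · linear_combination (-(x.2.2 - conj x.2.2)) * hvc
    · linear_combination (x.2.1 - conj x.2.1) * hvc
    · linear_combination (x.2.1 - conj x.2.1) * hvc
    · linear_combination (-(x.1 - conj x.1)) * hvc
  have e : quotMat v x =
      (lform v x)⁻¹ • (lform v x • (1 : Mat2) - subConj (ofCoords x) * lgrad v x) := by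
    rw [quotMat, smul_sub, smul_smul, inv_mul_cancel₀ hw, one_smul]
  rw [e, Matrix.smul_mul, Matrix.mul_smul, key, smul_smul, smul_smul]
  congr 1
  field_simp

lemma hasWirt_lgrad (v : Vec5) (x : ℂ × ℂ × ℂ) (l m i j : Fin 2) :
    ∃ d, HasWirt (fun y => lgrad v y l m) x (crdDir i j) d 0 := by
  fin_cases l <;> fin_cases m <;> simp only [lgrad]
  · exact ⟨_, ((HasWirt.snd_snd.const_mul _).add (HasWirt.const _)).congr_val rfl (by simp)⟩
  · exact ⟨_, ((HasWirt.const _).sub (HasWirt.snd_fst.const_mul _)).congr_val rfl (by simp)⟩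
  · exact ⟨_, ((HasWirt.const _).sub (HasWirt.snd_fst.const_mul _)).congr_val rfl (by simp)⟩
  · exact ⟨_, ((HasWirt.fst.const_mul _).add (HasWirt.const _)).congr_val rfl (by simp)⟩

/-- Only the conjugate derivative is needed: w and its gradient are holomorphic, so it falls on Z -
conj Z alone. -/
lemma hasWirt_quotMat (v : Vec5) {x : ℂ × ℂ × ℂ} (hw : lform v x ≠ 0) (l m i j : Fin 2) :
    ∃ d, HasWirt (fun y => quotMat v y l m) x (crdDir i j) d
      ((lform v x)⁻¹ * (symDir i j * lgrad v x) l m) := by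
  obtain ⟨d0, h0⟩ := hasWirt_lgrad v x 0 m i j
  obtain ⟨d1, h1⟩ := hasWirt_lgrad v x 1 m i j
  have h := (HasWirt.const ((1 : Mat2) l m)).sub ((((hasWirt_lform v x i j).inv hw)).mul
    (((hasWirt_subConj l 0 i j x).mul h0).add ((hasWirt_subConj l 1 i j x).mul h1)))
  have e : (fun y => quotMat v y l m) = fun y => (1 : Mat2) l m - (lform v y)⁻¹ *
      (subConj (ofCoords y) l 0 * lgrad v y 0 m + subConj (ofCoords y) l 1 * lgrad v y 1 m) := by
    ext y
    simp [quotMat, Matrix.mul_apply, Fin.sum_univ_two]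
  rw [e]
  refine ⟨_, h.congr_val rfl ?_⟩
  rw [Matrix.mul_apply, Fin.sum_univ_two]
  ring

/-- The conjugate derivative of Z - conj Z contributes the constant 3/2 = (2 + 1)/2, which matches
the shift of β in Ω. -/
lemma sum_entryWeight_mul_symDir (V : Mat2) (m j : Fin 2) :
    ∑ l, entryWeight m l * (symDir m l * V) l j = 3 / 2 * V m j := by
  fin_cases m <;> fin_cases j <;>
    simp [Fin.sum_univ_two, entryWeight, symDir, Matrix.mul_apply, Matrix.single] <;> ring

/-- Each term of the series is annihilated by `Ω`. -/
theorem opOmegaE_localTerm {k : ℤ} {s A B : ℝ} (hs : s * (3 / 2 - k - s) = 0)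
    (hA : A = -(1 / 2 + s)) (hB : B = 1 / 2 - k - s) {v : Vec5} (hv : IsIsotropic v)
    {w₀ : ℂ} (hw₀ : w₀ ≠ 0) {x : ℂ × ℂ × ℂ} (hx : 0 < imDet x)
    (hsl : w₀⁻¹ * lform v x ∈ Complex.slitPlane) (i j : Fin 2) :
    opOmegaE (1 / 2) ((k : ℂ) - 1 / 2) (localTerm s A B v w₀) i j x = 0 := by
  have hl0 : lform v x ≠ 0 := right_ne_zero_of_mul (Complex.slitPlane_ne_zero hsl)
  have hc0 : cdet x ≠ 0 := by rw [cdet_eq]; exact_mod_cast hx.ne'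
  have hcont : Continuous fun y : ℂ × ℂ × ℂ => w₀⁻¹ * lform v y := by
    unfold lform; fun_prop
  have hcontd : Continuous imDet := by
    unfold imDet; fun_prop
  have hnear : ∀ l, opKE (1 / 2) (localTerm s A B v w₀) l j =ᶠ[nhds x] fun y =>
      (1 / 2 + s) * (localTerm s A B v w₀ y * quotMat v y l j) := by
    intro l
    filter_upwards [hcont.continuousAt.preimage_mem_nhds (Complex.isOpen_slitPlane.mem_nhds hsl),
      hcontd.continuousAt.preimage_mem_nhds (isOpen_Ioi.mem_nhds hx)] with y hy1 hy2
    exact opKE_localTerm s A B v hw₀ hy2 hy1 hA l j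
  set f := localTerm s A B v w₀ x with hf
  set U := subConj (ofCoords x) with hU
  set V : Mat2 := (lform v x)⁻¹ • lgrad v x with hV
  set Vc : Mat2 := (conj (lform v x))⁻¹ • (lgrad v x).map conj with hVc
  have hVQ : Vc * quotMat v x = V := conj_lgrad_mul_quotMat hv hl0
  have hQ : quotMat v x = 1 - U * V := by rw [quotMat, hV, Matrix.mul_smul]
  -- The three summands are the conjugate derivatives of the power of conj w, of the power of det Y
  -- and of 1 - U V. The isotropy identity merges the first and third into (B + 3/2) V after
  -- summation.
  have hbar : ∀ m l, entryWeight m l • wirtBarE m l (opKE (1 / 2) (localTerm s A B v w₀) l j) x =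
      (1 / 2 + s) * f * (B * (Vc m l * quotMat v x l j) +
        s / (4 * cdet x) * (U.adjugate m l * quotMat v x l j) +
          entryWeight m l * (symDir m l * V) l j) := by
    intro m l
    obtain ⟨d, hq⟩ := hasWirt_quotMat v hl0 l j m l
    rw [wirtBarE_congr (hnear l),
      (((hasWirt_localTerm s A B v hw₀ hx hsl m l).mul hq).const_mul (1 / 2 + s : ℂ)).wirtBarE_eq,
      smul_eq_mul, ← hf, ← hU, hV, Matrix.mul_smul]
    have h1 := entryWeight_ne_zero m l
    simp only [hVc, Matrix.smul_apply, Matrix.map_apply, smul_eq_mul, map_div₀]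
    have hl0c : conj (lform v x) ≠ 0 := by simpa using hl0
    field_simp
  have hin : ∀ m, ∑ l, entryWeight m l •
      wirtBarE m l (opKE (1 / 2) (localTerm s A B v w₀) l j) x =
      (1 / 2 + s) * f * ((B + 3 / 2) * V m j +
        s / (4 * cdet x) * (U.adjugate * quotMat v x) m j) := by
    intro m
    rw [Finset.sum_congr rfl fun l _ => hbar m l, ← Finset.mul_sum, Finset.sum_add_distrib,
      Finset.sum_add_distrib, ← Finset.mul_sum, ← Finset.mul_sum, ← Matrix.mul_apply,
      ← Matrix.mul_apply, hVQ, sum_entryWeight_mul_symDir]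
    ring
  have hout : ∑ m, U i m • ∑ l, entryWeight m l •
      wirtBarE m l (opKE (1 / 2) (localTerm s A B v w₀) l j) x =
      (1 / 2 + s) * f * ((B + 3 / 2) * (U * V) i j - s * quotMat v x i j) := by
    have h1 : U * (U.adjugate * quotMat v x) = (-4 * cdet x) • quotMat v x := by
      rw [← Matrix.mul_assoc, hU, subConj_mul_adjugate x, Matrix.smul_mul, Matrix.one_mul]
    have h2 : ∀ m, U i m • ∑ l, entryWeight m l •
        wirtBarE m l (opKE (1 / 2) (localTerm s A B v w₀) l j) x =
        (1 / 2 + s) * f * ((B + 3 / 2) * (U i m * V m j) +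
          s / (4 * cdet x) * (U i m * (U.adjugate * quotMat v x) m j)) := by
      intro m
      rw [hin, smul_eq_mul]; ring
    rw [Finset.sum_congr rfl fun m _ => h2 m, ← Finset.mul_sum, Finset.sum_add_distrib,
      ← Finset.mul_sum, ← Finset.mul_sum, ← Matrix.mul_apply, ← Matrix.mul_apply, h1,
      Matrix.smul_apply, smul_eq_mul]
    field_simp
    ring
  rw [opOmegaE, hout, (hnear i).eq_of_nhds]
  have hBc : (B : ℂ) = 1 / 2 - k - s := by rw [hB]; push_cast; rfl
  simp only [smul_eq_mul, ← hf, hBc, hQ, Matrix.sub_apply]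
  have hsc : (s : ℂ) * (3 / 2 - k - s) = 0 := by
    have := congrArg (fun r : ℝ => (r : ℂ)) hs
    push_cast at this
    exact this
  -- The coefficient of U V vanishes identically by the choice of B; that of the identity matrix is
  -- s (3/2 - k - s).
  linear_combination (f * (1 : Mat2) i j) * hsc

/-! ### Real-analyticity and harmonicity of the series -/

open scoped BoundedContinuousFunction

/-! ### Complex powers in a commutative Banach algebra -/

section BinomialPower

variable {E : Type*} [NormedCommRing E] [NormedAlgebra ℂ E] [NormOneClass E]

/-- The coefficients are scalars, so their norms, and hence the radius bound, are those of the
complex binomial series. -/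
lemma one_le_radius_binomialSeries (a : ℂ) : 1 ≤ (binomialSeries E a).radius := by
  refine ENNReal.le_of_forall_nnreal_lt fun r hr => ?_
  obtain ⟨C, -, hC⟩ := (binomialSeries ℂ a).norm_mul_pow_le_of_lt_radius
    (hr.trans_le binomialSeries_radius_ge_one)
  refine (binomialSeries E a).le_radius_of_bound C fun n => ?_
  simpa only [binomialSeries, FormalMultilinearSeries.ofScalars_norm] using hC n

/-- The function `e ↦ (1 + e) ^ a` on the unit ball of a Banach algebra. -/
def binomPow (a : ℂ) (e : E) : E := (binomialSeries E a).sum e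

variable [CompleteSpace E]

lemma hasFPowerSeriesOnBall_binomPow (a : ℂ) :
    HasFPowerSeriesOnBall (binomPow a) (binomialSeries E a) 0 1 :=
  ((binomialSeries E a).hasFPowerSeriesOnBall
    (one_pos.trans_le (one_le_radius_binomialSeries a))).mono one_pos
    (one_le_radius_binomialSeries a)

end BinomialPower

/-! ### Bounded families and summable functionals -/

section Family

variable {ι : Type*} [TopologicalSpace ι]

/-- Evaluation at an index is a continuous algebra homomorphism, so it carries the binomial series
to the scalar one. -/
lemma binomPow_apply [Nonempty ι] (a : ℂ) {e : ι →ᵇ ℂ} (he : ‖e‖ < 1) (i : ι) :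
    binomPow a e i = (1 + e i) ^ a := by
  have h1 := (hasFPowerSeriesOnBall_binomPow (E := ι →ᵇ ℂ) a).hasSum (y := e)
    (by rw [← ENNReal.ofReal_one, Metric.eball_ofReal]; simpa using he)
  have h2 := h1.mapL (BoundedContinuousFunction.evalCLM ℂ i)
  have hei : ‖e i‖ < 1 := (e.norm_coe_le_norm i).trans_lt he
  have h3 := (Complex.one_add_cpow_hasFPowerSeriesOnBall_zero (a := a)).hasSum (y := e i)
    (by rw [← ENNReal.ofReal_one, Metric.eball_ofReal]; simpa using hei)
  simp only [zero_add, binomialSeries_apply, List.ofFn_const, List.prod_replicate] at h2 h3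
  refine h2.unique ?_
  convert! h3 using 2 with n

/-- The linear functional `e ↦ ∑ c i * e i` for a summable family `c`. -/
lemma exists_clm_tsum {c : ι → ℂ} (hc : Summable fun i => ‖c i‖) :
    ∃ L : (ι →ᵇ ℂ) →L[ℂ] ℂ, ∀ e, L e = ∑' i, c i * e i := by
  have hs : Summable fun i => c i • (BoundedContinuousFunction.evalCLM ℂ i : (ι →ᵇ ℂ) →L[ℂ] ℂ) := by
    refine Summable.of_norm_bounded hc fun i => ?_
    rw [norm_smul]
    refine mul_le_of_le_one_right (norm_nonneg _) ?_
    refine ContinuousLinearMap.opNorm_le_bound _ zero_le_one fun e => ?_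
    simpa using e.norm_coe_le_norm i
  refine ⟨∑' i, c i • (BoundedContinuousFunction.evalCLM ℂ i : (ι →ᵇ ℂ) →L[ℂ] ℂ), fun e => ?_⟩
  have := hs.hasSum.mapL (ContinuousLinearMap.apply ℂ ℂ e)
  exact (this.tsum_eq).symm

end Family

lemma weightFun_mul (k : ℤ) (s : ℝ) (z w : ℂ) :
    weightFun k s (z * w) = weightFun k s z * weightFun k s w := by
  simp only [weightFun, norm_mul, map_mul, mul_zpow, Real.mul_rpow (norm_nonneg _) (norm_nonneg _),
    Complex.ofReal_mul]
  ring

lemma weightFun_eq_cpow {k : ℤ} {s A B : ℝ} (hA : A = -(1 / 2 + s)) (hB : B = 1 / 2 - k - s)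
    {w : ℂ} (hw : w ≠ 0) : weightFun k s w = w ^ (A : ℂ) * conj (w ^ (B : ℂ)) := by
  have h := autFactor_eq (-A : ℂ) (-B : ℂ) w hw (1 - k) (by rw [hA, hB]; push_cast; ring)
  rw [autFactor, neg_neg, map_neg, neg_neg, Complex.conj_ofReal] at h
  rw [h, weightFun, Complex.ofReal_cpow (norm_nonneg _), hA]
  congr 2
  push_cast; ring

lemma analyticAt_conj {f : ℂ × ℂ × ℂ → ℂ} {x : ℂ × ℂ × ℂ} (hf : AnalyticAt ℝ f x) :
    AnalyticAt ℝ (fun y => conj (f y)) x :=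
  (Complex.conjCLE.toContinuousLinearMap.analyticAt _).comp hf

lemma analyticAt_cdet (x : ℂ × ℂ × ℂ) : AnalyticAt ℝ cdet x := by
  have h1 : AnalyticAt ℝ (fun y : ℂ × ℂ × ℂ => y.1) x := analyticAt_fst
  have h2 : AnalyticAt ℝ (fun y : ℂ × ℂ × ℂ => y.2.1) x := analyticAt_fst.comp analyticAt_snd
  have h3 : AnalyticAt ℝ (fun y : ℂ × ℂ × ℂ => y.2.2) x := analyticAt_snd.comp analyticAt_snd
  have e : cdet = fun y : ℂ × ℂ × ℂ => (-1 / 4) * ((y.1 - conj y.1) * (y.2.2 - conj y.2.2) -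
      (y.2.1 - conj y.2.1) * (y.2.1 - conj y.2.1)) := by
    ext y
    simp [cdet, det_fin_two, subConj, ofCoords]
  rw [e]
  exact analyticAt_const.mul (((h1.sub (analyticAt_conj h1)).mul (h3.sub (analyticAt_conj h3))).sub
    ((h2.sub (analyticAt_conj h2)).mul (h2.sub (analyticAt_conj h2))))

lemma abs_le_height (v : Vec5) : |(v.1.1 : ℝ)| ≤ height v ∧ |(v.1.2.1 : ℝ)| ≤ height v ∧
    |(v.1.2.2 : ℝ)| ≤ height v ∧ |(v.2.1 : ℝ)| ≤ height v ∧ |(v.2.2 : ℝ)| ≤ height v := by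
  have := abs_nonneg (v.1.1 : ℝ); have := abs_nonneg (v.1.2.1 : ℝ)
  have := abs_nonneg (v.1.2.2 : ℝ); have := abs_nonneg (v.2.1 : ℝ)
  have := abs_nonneg (v.2.2 : ℝ)
  unfold height
  refine ⟨?_, ?_, ?_, ?_, ?_⟩ <;> linarith

/-- The family of quotients `w(x) / w(x₀) - 1` depends analytically on `x`, as a bounded family. -/
lemma exists_quotient_family {ι : Type*} [TopologicalSpace ι] [DiscreteTopology ι] {v : ι → Vec5}
    (hv : ∀ i, IsIsotropic (v i)) (hv0 : ∀ i, v i ≠ 0) {x₀ : ℂ × ℂ × ℂ}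
    (hx₀ : x₀ ∈ halfSpaceCoords) :
    ∃ X : ℂ × ℂ × ℂ → (ι →ᵇ ℂ), X x₀ = 0 ∧ (∀ x, AnalyticAt ℂ X x) ∧
      ∀ x i, 1 + X x i = (lform (v i) x₀)⁻¹ * lform (v i) x := by
  obtain ⟨c, B, hc, hxs⟩ := exists_mem_strip hx₀
  obtain ⟨K, -, hK⟩ := exists_height_le (B := B) hc
  have hw : ∀ i, lform (v i) x₀ ≠ 0 := fun i => lform_ne_zero (hv i) (hv0 i) hx₀
  -- The lower bound for the linear form makes the coefficients, divided by w(x₀), a bounded family.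
  -- The forms are linear in det Z, τ, z, τ' and 1, so the quotients are combinations of four fixed
  -- families with polynomial coefficients.
  have hbd : ∀ (i : ι) (n : ℤ), |(n : ℝ)| ≤ height (v i) → ‖(lform (v i) x₀)⁻¹ * (n : ℂ)‖ ≤ K := by
    intro i n hn
    rw [norm_mul, norm_inv, Complex.norm_intCast, inv_mul_le_iff₀ (norm_pos_iff.2 (hw i)), mul_comm]
    exact hn.trans (hK _ (hv i) (hv0 i) _ hxs)
  let Ua : ι →ᵇ ℂ := .ofNormedAddCommGroupDiscrete
    (fun i => (lform (v i) x₀)⁻¹ * ((v i).2.1 : ℂ)) K fun i => hbd i _ (abs_le_height _).2.2.2.1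
  let Ur : ι →ᵇ ℂ := .ofNormedAddCommGroupDiscrete
    (fun i => (lform (v i) x₀)⁻¹ * ((v i).1.2.2 : ℂ)) K fun i => hbd i _ (abs_le_height _).2.2.1
  let Up : ι →ᵇ ℂ := .ofNormedAddCommGroupDiscrete
    (fun i => (lform (v i) x₀)⁻¹ * ((v i).1.1 : ℂ)) K fun i => hbd i _ (abs_le_height _).1
  let Uq : ι →ᵇ ℂ := .ofNormedAddCommGroupDiscrete
    (fun i => (lform (v i) x₀)⁻¹ * ((v i).1.2.1 : ℂ)) K fun i => hbd i _ (abs_le_height _).2.1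
  refine ⟨fun x => ((x.1 * x.2.2 - x.2.1 ^ 2) - (x₀.1 * x₀.2.2 - x₀.2.1 ^ 2)) • Ua +
    (x.1 - x₀.1) • Ur + (x.2.2 - x₀.2.2) • Up + (2 * (x.2.1 - x₀.2.1)) • Uq, by simp,
    fun x => ?_, fun x i => ?_⟩
  · have h1 : AnalyticAt ℂ (fun y : ℂ × ℂ × ℂ => y.1) x := analyticAt_fst
    have h2 : AnalyticAt ℂ (fun y : ℂ × ℂ × ℂ => y.2.1) x := analyticAt_fst.comp analyticAt_snd
    have h3 : AnalyticAt ℂ (fun y : ℂ × ℂ × ℂ => y.2.2) x := analyticAt_snd.comp analyticAt_snd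
    exact ((((((h1.mul h3).sub (h2.pow 2)).sub analyticAt_const).smul analyticAt_const).add
      ((h1.sub analyticAt_const).smul analyticAt_const)).add
      ((h3.sub analyticAt_const).smul analyticAt_const)).add
      ((analyticAt_const.mul (h2.sub analyticAt_const)).smul analyticAt_const)
  · have e : ((lform (v i) x₀)⁻¹ * lform (v i) x₀) = 1 := inv_mul_cancel₀ (hw i)
    simp only [BoundedContinuousFunction.coe_add, BoundedContinuousFunction.coe_smul, Pi.add_apply,
      smul_eq_mul, Ua, Ur, Up, Uq, BoundedContinuousFunction.coe_ofNormedAddCommGroupDiscrete]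
    rw [← e]
    generalize (lform (v i) x₀)⁻¹ = u
    simp only [lform]
    ring

/-- The series over a family of isotropic vectors is real-analytic and harmonic. -/
theorem analyticAt_tsum_and_opOmegaE_tsum {ι : Type*} [Nonempty ι] {v : ι → Vec5}
    (hv : ∀ i, IsIsotropic (v i)) (hv0 : ∀ i, v i ≠ 0) {k : ℤ} {s : ℝ}
    (hs : s * (3 / 2 - k - s) = 0) {x₀ : ℂ × ℂ × ℂ} (hx₀ : x₀ ∈ halfSpaceCoords)
    (hsum : Summable fun i => ‖weightFun k s (lform (v i) x₀)‖) {F : ℂ × ℂ × ℂ → ℂ}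
    (hF : ∀ x ∈ halfSpaceCoords,
      F x = ∑' i, ((imDet x ^ s : ℝ) : ℂ) * weightFun k s (lform (v i) x)) :
    AnalyticAt ℝ F x₀ ∧ ∀ i j, opOmegaE (1 / 2) ((k : ℂ) - 1 / 2) F i j x₀ = 0 := by
  -- With the discrete topology, bounded continuous functions are all bounded families.
  let _ : TopologicalSpace ι := ⊥
  have : DiscreteTopology ι := ⟨rfl⟩
  obtain ⟨X, hX0, hXan, hX⟩ := exists_quotient_family hv hv0 hx₀
  obtain ⟨L, hL⟩ := exists_clm_tsum hsum
  set A : ℝ := -(1 / 2 + s) with hA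
  set B : ℝ := 1 / 2 - k - s with hB
  have hw : ∀ i, lform (v i) x₀ ≠ 0 := fun i => lform_ne_zero (hv i) (hv0 i) hx₀
  -- The i-th component is the i-th term of the series divided by the constant weight of w_i(x₀).
  -- Normalizing makes all quotients uniformly close to 1 near x₀, where the binomial series
  -- applies; the weights become the coefficients of L.
  let Ψ : ℂ × ℂ × ℂ → (ι →ᵇ ℂ) := fun x =>
    cdet x ^ (s : ℂ) • (binomPow (A : ℂ) (X x) * star (binomPow (B : ℂ) (X x)))
  have hpow : ∀ a : ℂ, AnalyticAt ℝ (fun x => binomPow a (X x)) x₀ := by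
    intro a
    have h1 : AnalyticAt ℂ (binomPow a) (X x₀) := by
      rw [hX0]; exact (hasFPowerSeriesOnBall_binomPow a).analyticAt
    exact (h1.comp (hXan x₀)).restrictScalars
  have hΨ : AnalyticAt ℝ Ψ x₀ := by
    have h1 : AnalyticAt ℝ (fun x => cdet x ^ (s : ℂ)) x₀ := by
      have hsl : cdet x₀ ∈ Complex.slitPlane := by
        rw [cdet_eq]; exact Complex.ofReal_mem_slitPlane.2 hx₀.2
      have : AnalyticAt ℂ (fun z : ℂ => z ^ (s : ℂ)) (cdet x₀) :=
        analyticAt_id.cpow analyticAt_const hsl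
      exact this.restrictScalars.comp (analyticAt_cdet x₀)
    have h2 : AnalyticAt ℝ (fun x => star (binomPow (B : ℂ) (X x))) x₀ :=
      ((starL' ℝ : (ι →ᵇ ℂ) ≃L[ℝ] (ι →ᵇ ℂ)).toContinuousLinearMap.analyticAt _).comp (hpow B)
    exact h1.smul ((hpow A).mul h2)
  have hnear : ∀ᶠ x in nhds x₀, ‖X x‖ < 1 := by
    have hc : ContinuousAt (fun x => ‖X x‖) x₀ := (hXan x₀).continuousAt.norm
    refine hc.eventually_lt continuousAt_const ?_
    simp [hX0]
  have hev : ∀ i, (fun x => BoundedContinuousFunction.evalCLM ℂ i (Ψ x)) =ᶠ[nhds x₀]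
      localTerm s A B (v i) (lform (v i) x₀) := by
    intro i
    filter_upwards [hnear] with x hx
    change cdet x ^ (s : ℂ) • (binomPow (A : ℂ) (X x) i * conj (binomPow (B : ℂ) (X x) i)) = _
    rw [binomPow_apply _ hx, binomPow_apply _ hx, hX, localTerm, smul_eq_mul]
  have hopen : IsOpen halfSpaceCoords := by
    have h1 : Continuous fun x : ℂ × ℂ × ℂ => x.1.im := by fun_prop
    have h2 : Continuous imDet := by unfold imDet; fun_prop
    exact (isOpen_lt continuous_const h1).inter (isOpen_lt continuous_const h2)
  have hFL : F =ᶠ[nhds x₀] fun x => L (Ψ x) := by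
    filter_upwards [hnear, hopen.mem_nhds hx₀] with x hx hxh
    rw [hF x hxh, hL]
    refine tsum_congr fun i => ?_
    change _ = _ * (cdet x ^ (s : ℂ) • (binomPow (A : ℂ) (X x) i *
      conj (binomPow (B : ℂ) (X x) i)))
    have hg : (lform (v i) x₀)⁻¹ * lform (v i) x ≠ 0 :=
      mul_ne_zero (inv_ne_zero (hw i)) (lform_ne_zero (hv i) (hv0 i) hxh)
    rw [binomPow_apply _ hx, binomPow_apply _ hx, hX, smul_eq_mul,
      ← weightFun_eq_cpow hA hB hg, mul_left_comm, ← weightFun_mul, mul_inv_cancel_left₀ (hw i),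
      cdet_eq, Complex.ofReal_cpow hxh.2.le]
  refine ⟨(((L.restrictScalars ℝ).analyticAt _).comp hΨ).congr hFL.symm, fun i j => ?_⟩
  rw [opOmegaE_congr hFL, opOmegaE_clm_comp hΨ]
  -- Ω commutes with evaluation at each index, and each component is a single local term; at x₀ its
  -- quotient is 1, away from the branch cut.
  have hzero : opOmegaE (1 / 2) ((k : ℂ) - 1 / 2) Ψ i j x₀ = 0 := by
    ext n
    change BoundedContinuousFunction.evalCLM ℂ n (opOmegaE (1 / 2) ((k : ℂ) - 1 / 2) Ψ i j x₀) = 0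
    rw [← opOmegaE_clm_comp hΨ, opOmegaE_congr (hev n)]
    refine opOmegaE_localTerm hs hA hB (hv n) (hw n) hx₀.2 ?_ i j
    rw [inv_mul_cancel₀ (hw n)]
    exact Complex.one_mem_slitPlane
  rw [hzero, map_zero]

/-! ### Convergence and growth of the series -/

lemma summable_height_comp {ι : Type*} {v : ι → Vec5} (hinj : Function.Injective v)
    (hv : ∀ i, IsIsotropic (v i)) : Summable fun i => height (v i) ^ (-4 : ℝ) := by
  let w : ι → {u : Vec5 // IsIsotropic u} := fun i => ⟨v i, hv i⟩
  have h : Function.Injective w := fun i j hij => hinj (congrArg Subtype.val hij)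
  have hs := summable_height_rpow.comp_injective h
  exact hs

/-- The series of absolute values converges, and its sum is bounded on every strip. -/
lemma exists_summable_weightFun {k : ℤ} {s : ℝ} (hκ : 4 ≤ k + 2 * s) {c B : ℝ} (hc : 0 < c) :
    ∃ S, 0 < S ∧ ∀ x ∈ strip c B, x ∈ halfSpaceCoords →
      (Summable fun q : Cosets => ‖weightFun k s (lform (minors q.out) x)‖) ∧
        ∑' q : Cosets, ‖weightFun k s (lform (minors q.out) x)‖ ≤ S := by
  obtain ⟨K, hK0, hK⟩ := exists_height_le (B := B) hc
  have hsum : Summable fun q : Cosets =>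
      K ^ (k + 2 * s) * height (minors q.out) ^ (-4 : ℝ) := by
    exact (summable_height_comp minors_out_injective fun _ => isIsotropic_minors _).mul_left _
  refine ⟨∑' q : Cosets, K ^ (k + 2 * s) * height (minors q.out) ^ (-4 : ℝ) + 1, ?_, ?_⟩
  · refine add_pos_of_nonneg_of_pos (tsum_nonneg fun q => ?_) one_pos
    have := zero_le_one.trans (one_le_height (minors q.out))
    positivity
  intro x hx hxh
  have hle : ∀ q : Cosets, ‖weightFun k s (lform (minors q.out) x)‖ ≤
      K ^ (k + 2 * s) * height (minors q.out) ^ (-4 : ℝ) := by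
    intro q
    have hv := isIsotropic_minors q.out
    have hv0 := minors_ne_zero q.out
    have hh := one_le_height (minors q.out)
    have hh0 : 0 < height (minors q.out) := one_pos.trans_le hh
    rw [norm_weightFun k s (lform_ne_zero hv hv0 hxh)]
    have h1 : K⁻¹ * height (minors q.out) ≤ ‖lform (minors q.out) x‖ := by
      rw [inv_mul_le_iff₀ hK0]; exact hK _ hv hv0 x hx
    calc ‖lform (minors q.out) x‖ ^ (-(k + 2 * s))
        ≤ (K⁻¹ * height (minors q.out)) ^ (-(k + 2 * s)) :=
          Real.rpow_le_rpow_of_nonpos (by positivity) h1 (by linarith)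
      _ = K ^ (k + 2 * s) * height (minors q.out) ^ (-(k + 2 * s)) := by
          rw [Real.mul_rpow (by positivity) hh0.le, Real.inv_rpow hK0.le, Real.rpow_neg hK0.le,
            inv_inv]
      _ ≤ _ := by
          gcongr
  have hs := Summable.of_nonneg_of_le (fun q => norm_nonneg _) hle hsum
  exact ⟨hs, (hs.tsum_le_tsum hle hsum).trans (by linarith)⟩

lemma summable_weightFun {k : ℤ} {s : ℝ} (hκ : 4 ≤ k + 2 * s) {x : ℂ × ℂ × ℂ}
    (hx : x ∈ halfSpaceCoords) :
    Summable fun q : Cosets => ‖weightFun k s (lform (minors q.out) x)‖ := by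
  obtain ⟨c, B, hc, hxs⟩ := exists_mem_strip hx
  obtain ⟨S, -, hS⟩ := exists_summable_weightFun hκ (B := B) hc
  exact (hS x hxs hx).1

lemma poincareSeries_eq (k : ℤ) (s : ℝ) {x : ℂ × ℂ × ℂ} (hx : x ∈ halfSpaceCoords) :
    poincareSeries k s (ofCoords x) =
      ∑' q : Cosets, ((imDet x ^ s : ℝ) : ℂ) * weightFun k s (lform (minors q.out) x) :=
  tsum_congr fun q => poincareTerm_eq k s q.out hx

lemma summable_poincareTerm {k : ℤ} {s : ℝ} (hκ : 4 ≤ k + 2 * s) {Z : Mat2}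
    (hZ : Z ∈ siegelHalfSpace) :
    Summable fun q : Cosets => poincareTerm k s q.out Z := by
  obtain ⟨x, hx, rfl⟩ := exists_ofCoords hZ
  refine Summable.congr ?_ fun q => (poincareTerm_eq k s q.out hx).symm
  exact (summable_weightFun hκ hx).of_norm.mul_left _

lemma norm_poincareSeries_le {k : ℤ} {s : ℝ} (hκ : 4 ≤ k + 2 * s) {x : ℂ × ℂ × ℂ}
    (hx : x ∈ halfSpaceCoords) :
    ‖poincareSeries k s (ofCoords x)‖ ≤
      imDet x ^ s * ∑' q : Cosets, ‖weightFun k s (lform (minors q.out) x)‖ := by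
  have hd : 0 ≤ imDet x ^ s := Real.rpow_nonneg hx.2.le _
  rw [poincareSeries_eq k s hx, tsum_mul_left, norm_mul, Complex.norm_real, Real.norm_eq_abs,
    abs_of_nonneg hd]
  exact mul_le_mul_of_nonneg_left (norm_tsum_le_tsum_norm (summable_weightFun hκ hx)) hd

/-- An integral translation moves X into |X| ≤ 1, where the sum of the weights is bounded in terms
of c alone. Only (det Y)^s ≤ (tr Y)^(2s) remains, so N does not depend on c. -/
lemma growth_poincareSeries {k : ℤ} (hk : Odd k) {s : ℝ} (hκ : 4 ≤ k + 2 * s) {N : ℕ}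
    (hN : 2 * s = N) {c : ℝ} (hc : 0 < c) :
    ∃ C : ℝ, 0 < C ∧ ∀ Z ∈ siegelHalfSpace,
      (imPart Z - c • (1 : Matrix (Fin 2) (Fin 2) ℝ)).PosSemidef →
        ‖poincareSeries k s Z‖ ≤ C * (imPart Z).trace ^ N := by
  obtain ⟨S, hS0, hS⟩ := exists_summable_weightFun hκ (B := 1) hc
  refine ⟨S, hS0, fun Z hZ hY => ?_⟩
  obtain ⟨x, hx, rfl⟩ := exists_ofCoords hZ
  have h1 := hY.diag_nonneg (i := 0)
  have h3 := hY.diag_nonneg (i := 1)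
  have h2 := hY.det_nonneg
  simp [imPart, ofCoords] at h1 h3
  simp [det_fin_two, imPart, ofCoords] at h2
  let T : ℤ × ℤ × ℤ := (-⌊x.1.re⌋, -⌊x.2.1.re⌋, -⌊x.2.2.re⌋)
  have hfl : ∀ r : ℝ, |r + ((-⌊r⌋ : ℤ) : ℝ)| ≤ 1 := fun r => by
    rw [abs_le]
    push_cast
    constructor <;> linarith [Int.floor_le r, Int.lt_floor_add_one r]
  set y : ℂ × ℂ × ℂ := (x.1 + T.1, x.2.1 + T.2.1, x.2.2 + T.2.2) with hy
  have hdet : imDet y = imDet x := by simp [imDet, hy]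
  have hyh : y ∈ halfSpaceCoords := by
    refine ⟨?_, ?_⟩
    · simpa [hy] using hx.1
    · rw [hdet]; exact hx.2
  have hys : y ∈ strip c 1 := by
    refine ⟨⟨?_, ?_, ?_⟩, ?_, ?_, ?_⟩
    · simpa [hy, T] using hfl x.1.re
    · simpa [hy, T] using hfl x.2.1.re
    · simpa [hy, T] using hfl x.2.2.re
    · simpa [hy] using h1
    · simpa [hy] using h3
    · simp only [hy, Complex.add_im, Complex.intCast_im, add_zero]
      nlinarith
  rw [← poincareSeries_add k hk s T hx, ← hy]
  refine (norm_poincareSeries_le hκ hyh).trans ?_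
  rw [mul_comm, hdet]
  have htr : (imPart (ofCoords x)).trace = x.1.im + x.2.2.im := by
    simp [trace_fin_two, imPart, ofCoords]
  have htr0 : 0 ≤ x.1.im + x.2.2.im := by linarith
  have hpow : imDet x ^ s ≤ (x.1.im + x.2.2.im) ^ N := by
    have hs0 : 0 ≤ s := by
      have : (0 : ℝ) ≤ N := N.cast_nonneg
      linarith
    calc imDet x ^ s ≤ ((x.1.im + x.2.2.im) ^ 2) ^ s := by
          refine Real.rpow_le_rpow hx.2.le ?_ hs0
          simp only [imDet]
          nlinarith [sq_nonneg x.2.1.im, sq_nonneg x.1.im, sq_nonneg x.2.2.im]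
      _ = _ := by
          rw [← Real.rpow_natCast, ← Real.rpow_mul htr0, ← Real.rpow_natCast, ← hN]
          norm_num
  rw [htr]
  exact mul_le_mul (hS y hys hyh).2 hpow (Real.rpow_nonneg hx.2.le _) hS0.le

/-- The Poincaré–Eisenstein series is a harmonic Siegel–Maass form whenever it converges
absolutely and its generating function `(det Y) ^ s` is harmonic. -/
theorem isHarmonicSiegelMaassForm_poincareSeries {k : ℤ} (hk : Odd k) {s : ℝ}
    (hκ : 4 ≤ k + 2 * s) (hs : s * (3 / 2 - k - s) = 0) {N : ℕ} (hN : 2 * s = N) :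
    IsHarmonicSiegelMaassForm k (poincareSeries k s) := by
  -- The algebra of bounded families has ‖1‖ = 1 only over a nonempty index set.
  have : Nonempty Cosets := ⟨Quotient.mk _ 1⟩
  have hmain : ∀ x ∈ halfSpaceCoords,
      AnalyticAt ℝ (fun y => poincareSeries k s (ofCoords y)) x ∧
      ∀ i j, opOmegaE (1 / 2) ((k : ℂ) - 1 / 2) (fun y => poincareSeries k s (ofCoords y)) i j x
        = 0 := fun x hx =>
    analyticAt_tsum_and_opOmegaE_tsum (v := fun q : Cosets => minors q.out)
      (fun _ => isIsotropic_minors _) (fun _ => minors_ne_zero _) hs hx (summable_weightFun hκ hx)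
      fun y hy => poincareSeries_eq k s hy
  refine ⟨fun x hx => ?_, fun M Z hZ => slash_poincareSeries k hk s M hZ, fun Z hZ => ?_,
    N, fun c hc => growth_poincareSeries hk hκ hN hc⟩
  · exact (hmain x ((ofCoords_mem_siegelHalfSpace x).1 hx)).1
  · obtain ⟨x, hx, rfl⟩ := exists_ofCoords hZ
    ext i j
    rw [opOmega_ofCoords]
    exact (hmain x hx).2 i j

end

end SiegelMaass

theorem mainTheorem4 (k : ℤ) (hk : Odd k) :
    (3 < k →
      (∀ Z ∈ SiegelMaass.siegelHalfSpace, Summable fun q : SiegelMaass.Cosets => SiegelMaass.poincareTerm k 0 q.out Z) ∧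
      SiegelMaass.IsHarmonicSiegelMaassForm k (SiegelMaass.poincareSeries k 0)) ∧
    (k < 0 →
      (∀ Z ∈ SiegelMaass.siegelHalfSpace,
        Summable fun q : SiegelMaass.Cosets => SiegelMaass.poincareTerm k (3 / 2 - (k : ℂ)) q.out Z) ∧
      SiegelMaass.IsHarmonicSiegelMaassForm k (SiegelMaass.poincareSeries k (3 / 2 - (k : ℂ)))) := by
  constructor
  · intro h
    have hκ : (4 : ℝ) ≤ k + 2 * (0 : ℝ) := by
      have : (4 : ℤ) ≤ k := h
      have : ((4 : ℤ) : ℝ) ≤ k := by exact_mod_cast this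
      push_cast at this
      linarith
    rw [← Complex.ofReal_zero]
    exact ⟨fun Z hZ => SiegelMaass.summable_poincareTerm hκ hZ,
      SiegelMaass.isHarmonicSiegelMaassForm_poincareSeries hk hκ (by simp) (N := 0) (by simp)⟩
  · intro h
    have hk1 : (k : ℝ) ≤ -1 := by
      have : k ≤ -1 := by omega
      exact_mod_cast this
    -- The exponent is 3 - k, which is at least 4 since k ≤ -1.
    have hκ : (4 : ℝ) ≤ k + 2 * (3 / 2 - k : ℝ) := by linarith
    have e : (3 / 2 - (k : ℂ)) = ((3 / 2 - k : ℝ) : ℂ) := by push_cast; rfl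
    -- The growth exponent 2s = 3 - 2k is a natural number because k is negative.
    have hN : 2 * (3 / 2 - k : ℝ) = ((3 - 2 * k).toNat : ℝ) := by
      have h1 : (((3 - 2 * k).toNat : ℤ) : ℝ) = ((3 - 2 * k : ℤ) : ℝ) := by
        rw [Int.toNat_of_nonneg (by omega)]
      rw [Int.cast_natCast] at h1
      rw [h1]
      push_cast
      ring
    rw [e]
    exact ⟨fun Z hZ => SiegelMaass.summable_poincareTerm hκ hZ,
      SiegelMaass.isHarmonicSiegelMaassForm_poincareSeries hk hκ (by simp) hN⟩
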